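/- For an integer $\lambda\ge 1$ and $n\in\{0,1,2,\dots\}$ let $C_n^{(\lambda)}$ be the Gegenbauer polynomial, $C_n^{(\lambda)}(x)=\frac{(2\lambda)_n}{(\lambda+1/2)_n}P_n^{(\lambda-1/2,\lambda-1/2)}(x)$, where $P_n^{(a,b)}(x)=\frac{(a+1)_n}{n!}\,{}_2F_1\big(-n,\,n+a+b+1;\,a+1;\,\frac{1-x}{2}\big)$ is the Jacobi polynomial and $(a)_n=a(a+1)\cdots(a+n-1)$. Put $$I_{m,n}^{(\lambda)}=\int_0^\pi \cos(2m\theta)\,\log\big(C_n^{(\lambda)}(\cos\theta)\big)^2\,d\theta,\qquad \alpha_{\nu,n}^{(\lambda)}=\frac{(1-\lambda)_\nu\,(n+1)_\nu}{\nu!\,(n+\lambda+1)_\nu}.$$ Let $\delta$ be the Kronecker delta, $[\cdot]$ the integer part, and read $1/z!$ as $0$ when $z$ is a negative integer. Below, $\alpha_\nu$ abbreviates $\alpha_{\nu,n}^{(\lambda)}$. **Proposition 3.** For every integer $\lambda\ge3$, when $1\le m\le n+\lambda$, the integral $I_{m,n}^{(\lambda)}$ converges absolutely and $$I_{m,n}^{(\lambda)}=\frac{(2\lambda-1)\pi}{m}-\pi\,\frac{\alpha_0}{\alpha_{\lambda-1}}\,\delta_{m,n+\lambda}-\pi\Big(\frac{\alpha_{\lambda-3}}{\alpha_{\lambda-2}}\Big)^{m}\sum_{k=1}^{m}\;\sum_{k_6=0}^{[m/3]}\sum_{k_8=0}^{[m/4]}\cdots\sum_{k_{2(\lambda-1)}=0}^{[m/(\lambda-1)]}\Big(-\frac{\alpha_{\lambda-2}^2}{\alpha_{\lambda-1}\alpha_{\lambda-3}}\Big)^{k}$$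 $$\times\frac{(k-1)!}{\big(2k-m+\sum_{r=1}^{\lambda-3}r\,k_{2r+4}\big)!\,\big(m-k-\sum_{s=1}^{\lambda-3}(s+1)k_{2s+4}\big)!}\;\prod_{j=3}^{\lambda-1}\frac{1}{(k_{2j})!}\Big(\frac{\alpha_{\lambda-1-j}\,\alpha_{\lambda-2}^{\,j-2}}{\alpha_{\lambda-3}^{\,j-1}}\Big)^{k_{2j}}.$$ (For $\lambda=3$ there are no indices $k_6,k_8,\dots$, and only the sum over $k$ remains.) In particular, for $\lambda=3$, when $1\le m\le n+3$, $$I_{m,n}^{(3)}=\frac{\pi}{m}\Big[5-2\,\mathrm{Re}\big(f(n)^m\big)\Big]-\pi\,\frac{(n+4)(n+5)}{(n+1)(n+2)}\,\delta_{m,n+3},\qquad f(n)=\frac{(n+1)(n+5)+i\sqrt{3(n+1)(n+5)}}{(n+1)(n+2)}.$$ -/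

import Mathlib

noncomputable section

namespace GegenbauerEntropy

open scoped Nat

/-- The Pochhammer symbol `(a)_n = a (a+1) ⋯ (a+n-1)`. -/
def poch (a : ℝ) (n : ℕ) : ℝ := (ascPochhammer ℝ n).eval a

/-- The Jacobi polynomial `P_n^{(a,b)}(x)`; the hypergeometric series terminates since its first
parameter is `-n`. -/
def jacobi (n : ℕ) (a b x : ℝ) : ℝ :=
  poch (a + 1) n / (n ! : ℝ) * ₂F₁ (-(n : ℝ)) (n + a + b + 1) (a + 1) ((1 - x) / 2)

/-- The Gegenbauer polynomial `C_n^{(lam)}(x)`. -/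
def gegenbauer (lam : ℝ) (n : ℕ) (x : ℝ) : ℝ :=
  poch (2 * lam) n / poch (lam + 1 / 2) n * jacobi n (lam - 1 / 2) (lam - 1 / 2) x

/-- The integrand of `I_{m,n}^{(lam)}`. -/
def integrandI (lam : ℝ) (m n : ℕ) (θ : ℝ) : ℝ :=
  Real.cos (2 * m * θ) * Real.log (gegenbauer lam n (Real.cos θ) ^ 2)

/-- `I_{m,n}^{(lam)} = ∫_0^π cos(2mθ) log (C_n^{(lam)}(cos θ))² dθ`. -/
def integralI (lam : ℝ) (m n : ℕ) : ℝ :=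
  ∫ θ in (0 : ℝ)..Real.pi, integrandI lam m n θ

/-- The coefficient `α_{ν,n}^{(lam)}`. -/
def alpha (lam : ℝ) (ν n : ℕ) : ℝ :=
  poch (1 - lam) ν * poch (n + 1) ν / ((ν ! : ℝ) * poch (n + lam + 1) ν)

/-- `1 / z!` for an integer `z`, equal to `0` when `z` is negative. -/
def invFact (z : ℤ) : ℝ := if 0 ≤ z then 1 / ((z.toNat)! : ℝ) else 0

/-- The Kronecker delta. -/
def kdelta (a b : ℕ) : ℝ := if a = b then 1 else 0

/-- The summand of the multiple sum. The tuple `κ` lists `k_6, k_8, …, k_{2(l-1)}`: its entry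
`κ i` is `k_{2j}` with `j = i + 3`, for `i = 0, …, l - 4`. -/
def summand (l m n k : ℕ) (κ : Fin (l - 3) → ℕ) : ℝ :=
  (-(alpha l (l - 2) n ^ 2 / (alpha l (l - 1) n * alpha l (l - 3) n))) ^ k
    * (((k - 1)! : ℝ)
        * invFact (2 * (k : ℤ) - m + ∑ i : Fin (l - 3), (((i : ℕ) : ℤ) + 1) * (κ i : ℤ))
        * invFact ((m : ℤ) - k - ∑ i : Fin (l - 3), (((i : ℕ) : ℤ) + 2) * (κ i : ℤ)))
    * ∏ i : Fin (l - 3), (1 / ((κ i)! : ℝ)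
        * (alpha l (l - 1 - ((i : ℕ) + 3)) n * alpha l (l - 2) n ^ ((i : ℕ) + 1)
            / alpha l (l - 3) n ^ ((i : ℕ) + 2)) ^ (κ i))

/-- The multiple sum over `1 ≤ k ≤ m` and `0 ≤ k_{2j} ≤ ⌊m/j⌋`, `3 ≤ j ≤ l - 1`. -/
def multiSum (l m n : ℕ) : ℝ :=
  ∑ k ∈ Finset.Icc 1 m,
    ∑ κ ∈ Fintype.piFinset (fun i : Fin (l - 3) => Finset.Icc 0 (m / ((i : ℕ) + 3))),
      summand l m n k κ

/-- `f(n) = ((n+1)(n+5) + i √(3(n+1)(n+5))) / ((n+1)(n+2))`. -/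
def f (n : ℕ) : ℂ :=
  (((n : ℂ) + 1) * (n + 5) + Complex.I * (Real.sqrt (3 * ((n : ℝ) + 1) * (n + 5)) : ℂ))
    / (((n : ℂ) + 1) * (n + 2))

end GegenbauerEntropy

end

/-! Write `λ = l + 1` and `y = e^{iθ}`. Up to a nonzero scalar, `C_n^{(λ)}` is the `l`-th derivative
of the Chebyshev polynomial `U_{n+l}`, so by Gauss–Lucas all its zeros are real, `cos φ` with `φ ∈
s`. Hence `|C_n(cos θ)|` is a constant times the modulus at `y` of `∏ (1 - e^{iφ}X)(1 - e^{-iφ}X)`.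
The Fourier coefficients of `log |1 - e^{iφ}y|` are explicit, and the integral equals `-(π/m) ∑
cos(2mφ)` (`integralI_eq_sum_cos`).

This power sum is a coefficient of a formal logarithm. The finite expansion of `sin^{2λ-1}θ ·
C_n(cos θ)` in the `α_ν sin((n+2ν+1)θ)` (`sin_pow_mul_derivU`) becomes the polynomial identity `(1 -
X²)^{2l+1} ∏ = A(X²) - X^{2(n+λ)} B(X²)`, where `A` and `B` have coefficients `α_ν/α_l` in reversed
and natural order (`one_sub_sq_pow_mul_unitProd`). In the coefficient of `X^{2m}` of the logarithm,
`(1 - X²)^{2l+1}` yields `(2λ-1)/m`; as `m ≤ n+λ`, the `B` term matters only at `m = n+λ`, which is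
the Kronecker delta; what remains is the coefficient of `log A`.

The multinomial theorem expands `log A` into the multiple sum (`logCoeff_alphaRev`). For `λ = 3`,
`A` is quadratic and factors as `(1 - fX)(1 - f̄X)`. -/

noncomputable section

namespace GegenbauerEntropy

/-! ### Formal logarithms of power series with constant term 1. -/

section LogCoeff

open PowerSeries

variable {K : Type*} [Field K]

/-- The `m`-th coefficient of the formal logarithm of a power series with constant term `1`. -/
def logCoeff (F : K⟦X⟧) (m : ℕ) : K :=
  ∑ k ∈ Finset.Icc 1 m, (-1) ^ (k + 1) / (k : K) * coeff m ((F - 1) ^ k)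

theorem X_dvd_sub_one {F : K⟦X⟧} (hF : constantCoeff F = 1) : X ∣ F - 1 := by
  rw [X_dvd_iff]; simp [hF]

theorem coeff_sub_one_pow_of_lt {F : K⟦X⟧} (hF : constantCoeff F = 1) {m k : ℕ} (h : m < k) :
    coeff m ((F - 1) ^ k) = 0 :=
  X_pow_dvd_iff.mp (pow_dvd_pow_of_dvd (X_dvd_sub_one hF) k) m h

/-- The cut-off can be raised freely because `(F - 1)^k` has order at least `k`; this allows indices
`m` and `2m` to be compared. -/
theorem logCoeff_eq_sum_of_le {F : K⟦X⟧} (hF : constantCoeff F = 1) {m M : ℕ} (h : m ≤ M) :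
    logCoeff F m = ∑ k ∈ Finset.Icc 1 M, (-1) ^ (k + 1) / (k : K) * coeff m ((F - 1) ^ k) := by
  refine Finset.sum_subset (Finset.Icc_subset_Icc le_rfl h) fun k hk hk' => ?_
  rw [coeff_sub_one_pow_of_lt hF, mul_zero]
  simp only [Finset.mem_Icc] at hk hk'
  omega

/-- The coefficients of the formal logarithm are those of the logarithmic derivative. -/
theorem succ_mul_logCoeff [CharZero K] {F : K⟦X⟧} (hF : constantCoeff F = 1) (m : ℕ) :
    ((m : K) + 1) * logCoeff F (m + 1) = coeff m (d⁄dX K F * F⁻¹) := by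
  set g := F - 1 with hg
  have hFg : F = 1 + g := by rw [hg]; ring
  have hdg : d⁄dX K F = d⁄dX K g := by rw [hg]; simp
  have hinv : F * F⁻¹ = 1 := PowerSeries.mul_inv_cancel F (by simp [hF])
  have hterm : ∀ k ∈ Finset.Icc 1 (m + 1), ((m : K) + 1) *
      ((-1) ^ (k + 1) / (k : K) * coeff (m + 1) (g ^ k))
      = coeff m ((-g) ^ (k - 1) * d⁄dX K g) := by
    intro k hk
    obtain ⟨j, rfl⟩ : ∃ j, k = j + 1 := ⟨k - 1, by simp only [Finset.mem_Icc] at hk; omega⟩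
    have h1 := coeff_derivative (g ^ (j + 1)) m
    rw [derivative_pow] at h1
    have h2 : coeff m ((-g) ^ j * d⁄dX K g) = (-1) ^ j * coeff m (g ^ j * d⁄dX K g) := by
      rw [neg_pow, mul_assoc]
      have : ((-1 : K⟦X⟧) ^ j) = C ((-1 : K) ^ j) := by simp
      rw [this, coeff_C_mul]
    have h3 : coeff m (((j + 1 : ℕ) : K⟦X⟧) * g ^ j * d⁄dX K g)
        = ((j : K) + 1) * coeff m (g ^ j * d⁄dX K g) := by
      have : ((j + 1 : ℕ) : K⟦X⟧) = C ((j : K) + 1) := by simp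
      rw [this, mul_assoc, coeff_C_mul]
    have hj : ((j : K) + 1) ≠ 0 := Nat.cast_add_one_ne_zero j
    simp only [Nat.add_sub_cancel] at h1 ⊢
    rw [h3] at h1
    rw [h2]
    push_cast
    field_simp
    linear_combination (-(-1 : K) ^ j) * h1
  rw [logCoeff, Finset.mul_sum, Finset.sum_congr rfl hterm, ← map_sum, ← Finset.sum_mul]
  -- Truncated geometric series for `1/(1 + g)`; the remainder has order at least `m + 1`, invisible
  -- to the `m`-th coefficient.
  have hgeom : ∑ k ∈ Finset.Icc 1 (m + 1), (-g) ^ (k - 1) = F⁻¹ - (-g) ^ (m + 1) * F⁻¹ := by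
    have h1 : ∑ k ∈ Finset.Icc 1 (m + 1), (-g) ^ (k - 1) = ∑ k ∈ Finset.range (m + 1), (-g) ^ k := by
      rw [Finset.range_eq_Ico, Finset.sum_Ico_eq_sum_range, ← Finset.Ico_add_one_right_eq_Icc,
        Finset.sum_Ico_eq_sum_range]
      simp
    have h2 := geom_sum_mul (-g) (m + 1)
    rw [h1]
    calc _ = (∑ k ∈ Finset.range (m + 1), (-g) ^ k) * (F * F⁻¹) := by rw [hinv, mul_one]
      _ = -((∑ k ∈ Finset.range (m + 1), (-g) ^ k) * (-g - 1)) * F⁻¹ := by rw [hFg]; ring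
      _ = _ := by rw [h2]; ring
  rw [hgeom, hdg, sub_mul, map_sub]
  have : coeff m ((-g) ^ (m + 1) * F⁻¹ * d⁄dX K g) = 0 := by
    refine X_pow_dvd_iff.mp ?_ m (Nat.lt_succ_self m)
    refine Dvd.dvd.mul_right (Dvd.dvd.mul_right (pow_dvd_pow_of_dvd ?_ _) _) _
    exact (dvd_neg.mpr (X_dvd_sub_one hF))
  rw [this, sub_zero, mul_comm]

theorem logCoeff_zero (F : K⟦X⟧) : logCoeff F 0 = 0 := by simp [logCoeff]

/-- Additivity is inherited from the logarithmic derivative, `(FG)'/(FG) = F'/F + G'/G`; index 0 is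
separate since the derivative does not see it. -/
theorem logCoeff_mul [CharZero K] {F G : K⟦X⟧} (hF : constantCoeff F = 1)
    (hG : constantCoeff G = 1) (m : ℕ) :
    logCoeff (F * G) m = logCoeff F m + logCoeff G m := by
  rcases m with _ | m
  · simp [logCoeff_zero]
  have hm : ((m : K) + 1) ≠ 0 := Nat.cast_add_one_ne_zero m
  refine mul_left_cancel₀ hm ?_
  rw [mul_add, succ_mul_logCoeff hF, succ_mul_logCoeff hG,
    succ_mul_logCoeff (by simp [hF, hG]), ← map_add]
  congr 1
  have h1 : F * F⁻¹ = 1 := PowerSeries.mul_inv_cancel F (by simp [hF])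
  have h2 : G * G⁻¹ = 1 := PowerSeries.mul_inv_cancel G (by simp [hG])
  rw [PowerSeries.mul_inv_rev, Derivation.leibniz, smul_eq_mul, smul_eq_mul]
  linear_combination (d⁄dX K G * G⁻¹) * h1 + (d⁄dX K F * F⁻¹) * h2

theorem logCoeff_one (m : ℕ) : logCoeff (1 : K⟦X⟧) m = 0 := by
  refine Finset.sum_eq_zero fun k hk => ?_
  rw [sub_self, zero_pow (by simp only [Finset.mem_Icc] at hk; omega)]
  simp

theorem logCoeff_pow [CharZero K] {F : K⟦X⟧} (hF : constantCoeff F = 1) (j m : ℕ) :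
    logCoeff (F ^ j) m = j * logCoeff F m := by
  induction j with
  | zero => simp [logCoeff_one]
  | succ j ih =>
    rw [pow_succ, logCoeff_mul (by simp [hF]) hF, ih]; push_cast; ring

theorem logCoeff_multiset_prod [CharZero K] {ι : Type*} (s : Multiset ι) (F : ι → K⟦X⟧)
    (hF : ∀ i, constantCoeff (F i) = 1) (m : ℕ) :
    logCoeff (s.map F).prod m = (s.map fun i => logCoeff (F i) m).sum := by
  induction s using Multiset.induction_on with
  | empty => simp [logCoeff_one]
  | cons a s ih =>
    have h1 : constantCoeff (s.map F).prod = 1 := by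
      rw [map_multiset_prod, Multiset.map_map]
      simp [hF]
    simp [logCoeff_mul (hF a) h1, ih]

theorem logCoeff_one_sub_C_mul_X (u : K) {m : ℕ} (hm : 1 ≤ m) :
    logCoeff (1 - C u * X : K⟦X⟧) m = -(u ^ m / m) := by
  rw [logCoeff, Finset.sum_eq_single_of_mem m (by simp [hm])]
  · have : ((1 : K⟦X⟧) - C u * X - 1) ^ m = C ((-u) ^ m) * X ^ m := by
      rw [map_pow, map_neg, ← mul_pow]; ring
    rw [this, coeff_C_mul, coeff_X_pow_self, neg_pow u, pow_succ]
    have h1 : ((-1 : K) ^ m) * (-1) ^ m = 1 := by rw [← mul_pow]; simp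
    linear_combination (-(u ^ m / m)) * h1
  · intro k _ hk
    have : ((1 : K⟦X⟧) - C u * X - 1) ^ k = C ((-u) ^ k) * X ^ k := by
      rw [map_pow, map_neg, ← mul_pow]; ring
    rw [this, coeff_C_mul, coeff_X_pow, if_neg (Ne.symm hk)]
    simp

/-- Adding a term of order `N` changes the logarithm up to order `N` only by that term. -/
theorem logCoeff_sub_X_pow_mul {B : K⟦X⟧} (hB : constantCoeff B = 1) (E : K⟦X⟧) {m N : ℕ}
    (hm : 1 ≤ m) (hmN : m ≤ N) :
    logCoeff (B - X ^ N * E) m = logCoeff B m - if m = N then constantCoeff E else 0 := by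
  -- For `k ≥ 2` the perturbation `X^N E` is always multiplied by another factor of positive order,
  -- so it first shows at order `N + 1`. Only `k = 1` sees it.
  have key : ∀ k, 2 ≤ k → coeff m ((B - X ^ N * E - 1) ^ k) = coeff m ((B - 1) ^ k) := by
    intro k hk
    rw [← sub_eq_zero, ← map_sub]
    refine X_pow_dvd_iff.mp ?_ m (Nat.lt_succ_of_le hmN)
    obtain ⟨j, rfl⟩ : ∃ j, k = j + 2 := ⟨k - 2, by omega⟩
    have e : (B - X ^ N * E - 1) ^ (j + 2) - (B - 1) ^ (j + 2)
        = (B - X ^ N * E - 1) * ((B - X ^ N * E - 1) ^ (j + 1) - (B - 1) ^ (j + 1))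
          - X ^ N * (B - 1) * (E * (B - 1) ^ j) := by ring
    have hX : X ∣ B - X ^ N * E - 1 := by
      rw [sub_right_comm]
      exact dvd_sub (X_dvd_sub_one hB) (Dvd.dvd.mul_right (dvd_pow_self X (by omega)) E)
    have hXN : X ^ N ∣ (B - X ^ N * E - 1) ^ (j + 1) - (B - 1) ^ (j + 1) := by
      refine dvd_trans ?_ (sub_dvd_pow_sub_pow _ _ _)
      exact ⟨-E, by ring⟩
    rw [e]
    refine dvd_sub ?_ ?_
    · rw [pow_succ']
      exact mul_dvd_mul hX hXN
    · rw [pow_succ]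
      exact Dvd.dvd.mul_right (mul_dvd_mul_left _ (X_dvd_sub_one hB)) _
  obtain ⟨M, rfl⟩ : ∃ M, m = M + 1 := ⟨m - 1, by omega⟩
  rw [logCoeff, logCoeff, ← Finset.add_sum_Ioc_eq_sum_Icc hm, ← Finset.add_sum_Ioc_eq_sum_Icc hm]
  rw [Finset.sum_congr rfl fun k hk => by
    rw [key k (by simp only [Finset.mem_Ioc] at hk; omega)]]
  have h1 : coeff (M + 1) (X ^ N * E) = if M + 1 = N then constantCoeff E else 0 := by
    rw [coeff_X_pow_mul']
    split_ifs with h h' h'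
    · simp [h']
    · omega
    · omega
    · rfl
  simp only [pow_one, map_sub, h1]
  norm_num
  ring

/-- Replacing `X` by `X ^ 2` doubles the index. -/
theorem logCoeff_expand_two {p : Polynomial K} (hp : p.coeff 0 = 1) (m : ℕ) :
    logCoeff ((Polynomial.expand K 2 p : Polynomial K) : K⟦X⟧) (2 * m)
      = logCoeff (p : K⟦X⟧) m := by
  have h1 : constantCoeff (p : K⟦X⟧) = 1 := by simpa using hp
  rw [logCoeff_eq_sum_of_le h1 (show m ≤ 2 * m by omega), logCoeff]
  refine Finset.sum_congr rfl fun k _ => ?_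
  congr 1
  have h2 : ((Polynomial.expand K 2 p : Polynomial K) : K⟦X⟧) - 1
      = ((Polynomial.expand K 2 (p - 1) : Polynomial K) : K⟦X⟧) := by simp
  have h3 : (p : K⟦X⟧) - 1 = ((p - 1 : Polynomial K) : K⟦X⟧) := by simp
  rw [h2, h3, ← Polynomial.coe_pow, ← Polynomial.coe_pow, ← map_pow, Polynomial.coeff_coe,
    Polynomial.coeff_coe, mul_comm, Polynomial.coeff_expand_mul (by norm_num)]

end LogCoeff

end GegenbauerEntropy

end

noncomputable section

namespace GegenbauerEntropy

open scoped Nat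

/-! ### Gegenbauer polynomials of integer order: link with Chebyshev polynomials and sine expansion.
-/

section Ultraspherical

open Polynomial Polynomial.Chebyshev

theorem poch_zero (a : ℝ) : poch a 0 = 1 := by simp [poch]

theorem poch_succ (a : ℝ) (k : ℕ) : poch a (k + 1) = poch a k * (a + k) := by
  simp [poch, ascPochhammer_succ_eval]

theorem poch_pos {a : ℝ} (ha : 0 < a) (k : ℕ) : 0 < poch a k := ascPochhammer_pos k a ha

theorem poch_eq_zero_iff (a : ℝ) (k : ℕ) : poch a k = 0 ↔ ∃ j < k, (j : ℝ) = -a :=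
  ascPochhammer_eval_eq_zero_iff k a

/-- The `l`-th derivative of the Chebyshev polynomial `U_{n+l}`; it is a multiple of the
Gegenbauer polynomial `C_n^{(l+1)}`. -/
def derivU (R : Type*) [CommRing R] (l n : ℕ) : R[X] := derivative^[l] (U R ((n + l : ℕ) : ℤ))

theorem derivU_succ (R : Type*) [CommRing R] (l n : ℕ) :
    derivU R (l + 1) n = derivative (derivU R l (n + 1)) := by
  rw [derivU, derivU, Function.iterate_succ_apply', show n + 1 + l = n + (l + 1) by ring]

theorem map_derivU (l n : ℕ) : (derivU ℝ l n).map (algebraMap ℝ ℂ) = derivU ℂ l n := by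
  rw [derivU, derivU, ← iterate_derivative_map, map_U]

theorem natDegree_derivU (R : Type*) [CommRing R] [IsDomain R] [CharZero R] (l n : ℕ) :
    (derivU R l n).natDegree = n := by
  induction l generalizing n with
  | zero => simp [derivU, natDegree_U_natCast]
  | succ l ih => rw [derivU_succ, natDegree_derivative, ih]; rfl

theorem derivU_eval_one_ne_zero (l n : ℕ) : (derivU ℝ l n).eval 1 ≠ 0 := by
  have h := iterate_derivative_U_eval_one (R := ℝ) ((n + l : ℕ) : ℤ) l
  intro h0
  rw [derivU] at h0
  rw [h0, mul_zero] at h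
  have h1 : ((((n + l : ℕ) : ℤ) : ℝ) + 1) ≠ 0 := by push_cast; positivity
  rcases mul_eq_zero.mp h.symm with h2 | h2
  · rw [Int.cast_eq_zero, Finset.prod_eq_zero_iff] at h2
    obtain ⟨i, hi, h3⟩ := h2
    rw [Finset.mem_range] at hi
    push_cast at h3
    have hi' : (i : ℤ) < l := by exact_mod_cast hi
    nlinarith [Int.natCast_nonneg n, Int.natCast_nonneg i]
  · exact h1 h2

/-- The recurrence between successive derivatives of `U` at 1 has the ratios of a `₂F₁` with
parameters `-n`, `n + 2λ`, `λ + 1/2`, where `λ = l + 1`; `(-1/2)^k` comes from the argument `(1 -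
x)/2`. -/
theorem iterate_derivative_derivU_eval_one (l n k : ℕ) :
    (derivative^[k] (derivU ℝ l n)).eval 1 = (derivU ℝ l n).eval 1 *
      (poch (-(n : ℝ)) k * poch (n + 2 * ((l : ℝ) + 1)) k / poch ((l : ℝ) + 1 + 1 / 2) k
        * (-1 / 2) ^ k) := by
  induction k with
  | zero => simp [poch_zero]
  | succ k ih =>
    have h := iterate_derivative_U_eval_one_recurrence (R := ℝ) ((n + l : ℕ) : ℤ) (l + k)
    have e : ∀ j, derivative^[j] (derivU ℝ l n)
        = derivative^[l + j] (U ℝ ((n + l : ℕ) : ℤ)) := by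
      intro j
      rw [derivU, ← Function.iterate_add_apply, add_comm]
    rw [e] at ih
    rw [e, ← add_assoc]
    rw [ih] at h
    have hp : poch ((l : ℝ) + 1 + 1 / 2) k ≠ 0 := (poch_pos (by positivity) k).ne'
    have hq : (2 * ((l : ℝ) + k) + 3) ≠ 0 := by positivity
    have hq' : ((l : ℝ) + 1 + 1 / 2 + k) ≠ 0 := by positivity
    push_cast at h ⊢
    rw [poch_succ, poch_succ, poch_succ]
    refine mul_left_cancel₀ hq ?_
    rw [h]
    field_simp
    ring

theorem hypergeometric_neg_nat (n : ℕ) (b c z : ℝ) :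
    ₂F₁ (-(n : ℝ)) b c z = ∑ k ∈ Finset.range (n + 1),
      poch (-(n : ℝ)) k * poch b k / poch c k / (k ! : ℝ) * z ^ k := by
  rw [ordinaryHypergeometric_eq_tsum]
  simp only [smul_eq_mul]
  rw [tsum_eq_sum (s := Finset.range (n + 1))]
  · refine Finset.sum_congr rfl fun k _ => ?_
    simp only [poch]
    ring
  · intro k hk
    have : poch (-(n : ℝ)) k = 0 := by
      rw [poch_eq_zero_iff]
      exact ⟨n, by simpa using hk, by simp⟩
    rw [poch] at this
    simp [this]

theorem eval_derivU_eq_sum (l n : ℕ) (x : ℝ) :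
    (derivU ℝ l n).eval x = (derivU ℝ l n).eval 1 * ∑ k ∈ Finset.range (n + 1),
      poch (-(n : ℝ)) k * poch (n + 2 * ((l : ℝ) + 1)) k / poch ((l : ℝ) + 1 + 1 / 2) k
        / (k ! : ℝ) * ((1 - x) / 2) ^ k := by
  rw [← taylor_eval_sub (1 : ℝ), eval_eq_sum_range, natDegree_taylor, natDegree_derivU,
    Finset.mul_sum]
  refine Finset.sum_congr rfl fun k _ => ?_
  have h1 := iterate_derivative_derivU_eval_one l n k
  rw [← factorial_smul_hasseDeriv] at h1
  rw [LinearMap.smul_apply, eval_smul, nsmul_eq_mul] at h1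
  have hk : (k ! : ℝ) ≠ 0 := by positivity
  rw [taylor_coeff, show (1 - x) / 2 = (-1 / 2) * (x - 1) by ring, mul_pow]
  refine mul_left_cancel₀ hk ?_
  rw [← mul_assoc, h1]
  field_simp

/-- The Taylor expansion at 1 and the terminating hypergeometric series coincide up to
normalisation. The scalar is left unspecified: its logarithm integrates to 0 against `cos(2mθ)`. -/
theorem gegenbauer_eq_const_mul_derivU (l n : ℕ) :
    ∃ c : ℝ, c ≠ 0 ∧ ∀ x, gegenbauer ((l + 1 : ℕ) : ℝ) n x = c * (derivU ℝ l n).eval x := by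
  have h1 : 0 < poch ((l : ℝ) + 1 + 1 / 2) n := poch_pos (by positivity) n
  have h2 : 0 < poch (2 * ((l : ℝ) + 1)) n := poch_pos (by positivity) n
  have h0 := derivU_eval_one_ne_zero l n
  refine ⟨poch (2 * ((l : ℝ) + 1)) n / (n ! : ℝ) / (derivU ℝ l n).eval 1,
    div_ne_zero (by positivity) h0, fun x => ?_⟩
  rw [eval_derivU_eq_sum l n x, gegenbauer, jacobi, hypergeometric_neg_nat]
  push_cast
  rw [show (l : ℝ) + 1 - 1 / 2 + 1 = (l : ℝ) + 1 + 1 / 2 by ring,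
    show (n : ℝ) + ((l : ℝ) + 1 - 1 / 2) + ((l : ℝ) + 1 - 1 / 2) + 1
      = n + 2 * ((l : ℝ) + 1) by ring]
  generalize Finset.sum (M := ℝ) (Finset.range (n + 1)) _ = S
  generalize poch ((l : ℝ) + 1 + 1 / 2) n = t at *
  field_simp

theorem alpha_zero (lam : ℝ) (n : ℕ) : alpha lam 0 n = 1 := by simp [alpha, poch_zero]

theorem alpha_self (l n : ℕ) : alpha ((l + 1 : ℕ) : ℝ) (l + 1) n = 0 := by
  have : poch (1 - ((l + 1 : ℕ) : ℝ)) (l + 1) = 0 := by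
    rw [poch_eq_zero_iff]; exact ⟨l, by omega, by push_cast; ring⟩
  rw [alpha, this]; simp

theorem alpha_ne_zero {l v : ℕ} (n : ℕ) (hv : v ≤ l) : alpha ((l + 1 : ℕ) : ℝ) v n ≠ 0 := by
  have h1 : poch (1 - ((l + 1 : ℕ) : ℝ)) v ≠ 0 := by
    rw [Ne, poch_eq_zero_iff]
    rintro ⟨j, hj, h⟩
    have : (j : ℝ) = l := by rw [h]; push_cast; ring
    rw [Nat.cast_inj] at this
    omega
  have h2 : 0 < poch ((n : ℝ) + 1) v := poch_pos (by positivity) v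
  have h3 : 0 < poch ((n : ℝ) + ((l + 1 : ℕ) : ℝ) + 1) v := poch_pos (by positivity) v
  rw [alpha]
  exact div_ne_zero (mul_ne_zero h1 h2.ne') (by positivity)

theorem poch_succ_left (a : ℝ) (k : ℕ) : poch a (k + 1) = a * poch (a + 1) k := by
  simp [poch, ascPochhammer_succ_left, eval_comp]

/-- Comparison of the coefficients of `sin((n+2v+3)θ)` in the induction on `l` of
`sin_pow_mul_derivU`. -/
theorem alpha_recurrence (l n v : ℕ) :
    alpha ((l + 1 : ℕ) : ℝ) v (n + 1) * ((n : ℝ) + 2 * v + 1 - 2 * (l + 1) + 2)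
      - alpha ((l + 1 : ℕ) : ℝ) (v + 1) (n + 1) * ((n : ℝ) + 2 * v + 3 + 2 * (l + 1))
      = -((n : ℝ) + 1 + 2 * (l + 1)) * alpha ((l + 1 + 1 : ℕ) : ℝ) (v + 1) n := by
  have h3 : poch ((n : ℝ) + l + 3) v ≠ 0 := (poch_pos (by positivity) v).ne'
  have h4 : (n : ℝ) + l + 3 + v ≠ 0 := by positivity
  have h5 : (v ! : ℝ) ≠ 0 := by positivity
  simp only [alpha]
  push_cast
  rw [show (1 : ℝ) - (l + 1) = -l by ring, show (1 : ℝ) - (l + 1 + 1) = -l - 1 by ring,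
    show (n : ℝ) + 1 + (l + 1) + 1 = n + l + 3 by ring,
    show (n : ℝ) + (l + 1 + 1) + 1 = n + l + 3 by ring,
    poch_succ_left (-(l : ℝ) - 1), poch_succ_left ((n : ℝ) + 1), poch_succ (-(l : ℝ)),
    poch_succ ((n : ℝ) + 1 + 1), poch_succ ((n : ℝ) + l + 3), Nat.factorial_succ,
    show -(l : ℝ) - 1 + 1 = -l by ring]
  push_cast
  field_simp
  ring

/-- The finite sine expansion of the Gegenbauer polynomials of integer order. -/
theorem sin_pow_mul_derivU (l n : ℕ) :
    ∃ c : ℝ, ∀ θ : ℝ, Real.sin θ ^ (2 * l + 1) * (derivU ℝ l n).eval (Real.cos θ)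
      = c * ∑ v ∈ Finset.range (l + 1),
          alpha ((l + 1 : ℕ) : ℝ) v n * Real.sin (((n : ℝ) + 2 * v + 1) * θ) := by
  induction l generalizing n with
  | zero =>
    refine ⟨1, fun θ => ?_⟩
    have := U_real_cos θ (n : ℤ)
    simp [derivU, alpha_zero]
    rw [mul_comm, this]
    simp
  | succ l ih =>
    obtain ⟨c, hc⟩ := ih (n + 1)
    -- The new factor is the coefficient of `sin((n+1)θ)` produced below, so that the leading
    -- coefficient stays `α_0 = 1`.
    refine ⟨c * ((n : ℝ) + 1 + 2 * (l + 1)) / 2, fun θ => ?_⟩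
    set p := derivU ℝ l (n + 1) with hp
    -- With `L = sin^{2l+1}θ · p(cos θ)`, one has `sin^{2l+3}θ · p'(cos θ) = (2l+1) cos θ · L - sin
    -- θ · L'`. Both sides of the induction hypothesis are therefore differentiated.
    have hL : HasDerivAt (fun θ => Real.sin θ ^ (2 * l + 1) * p.eval (Real.cos θ))
        ((((2 * l + 1 : ℕ) : ℝ) * Real.sin θ ^ (2 * l) * Real.cos θ) * p.eval (Real.cos θ)
          + Real.sin θ ^ (2 * l + 1) * (p.derivative.eval (Real.cos θ) * (-Real.sin θ))) θ := by
      have h1 := (Real.hasDerivAt_sin θ).pow (2 * l + 1)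
      have h2 := (p.hasDerivAt (Real.cos θ)).comp θ (Real.hasDerivAt_cos θ)
      exact h1.mul h2
    have hR : HasDerivAt (fun θ => c * ∑ v ∈ Finset.range (l + 1),
          alpha ((l + 1 : ℕ) : ℝ) v (n + 1) * Real.sin ((((n + 1 : ℕ) : ℝ) + 2 * v + 1) * θ))
        (c * ∑ v ∈ Finset.range (l + 1), alpha ((l + 1 : ℕ) : ℝ) v (n + 1) *
          (Real.cos ((((n + 1 : ℕ) : ℝ) + 2 * v + 1) * θ) * (((n + 1 : ℕ) : ℝ) + 2 * v + 1))) θ := by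
      refine HasDerivAt.const_mul _ (HasDerivAt.fun_sum fun v _ => HasDerivAt.const_mul _ ?_)
      have h1 : HasDerivAt (fun θ : ℝ => (((n + 1 : ℕ) : ℝ) + 2 * v + 1) * θ)
        (((n + 1 : ℕ) : ℝ) + 2 * v + 1) θ := by
        simpa using (hasDerivAt_id θ).const_mul (((n + 1 : ℕ) : ℝ) + 2 * v + 1)
      exact h1.sin
    rw [funext hc] at hL
    have hd := hL.unique hR
    have hθ := hc θ
    rw [derivU_succ, ← hp]
    have hsum : ∀ v : ℕ, alpha ((l + 1 + 1 : ℕ) : ℝ) (v + 1) n * ((n : ℝ) + 1 + 2 * (l + 1))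
        * Real.sin (((n : ℝ) + 2 * ((v + 1 : ℕ) : ℝ) + 1) * θ)
        = (alpha ((l + 1 : ℕ) : ℝ) (v + 1) (n + 1) * ((n : ℝ) + 2 * v + 3 + 2 * (l + 1))
          - alpha ((l + 1 : ℕ) : ℝ) v (n + 1) * ((n : ℝ) + 2 * v + 1 - 2 * (l + 1) + 2)) *
          Real.sin (((n : ℝ) + 2 * ((v + 1 : ℕ) : ℝ) + 1) * θ) := by
      intro v
      linear_combination (Real.sin (((n : ℝ) + 2 * ((v + 1 : ℕ) : ℝ) + 1) * θ))
        * alpha_recurrence l n v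
    have htrig : ∀ v : ℕ, (2 * (l : ℝ) + 1) * Real.cos θ *
          Real.sin ((((n + 1 : ℕ) : ℝ) + 2 * v + 1) * θ)
        - Real.sin θ * (Real.cos ((((n + 1 : ℕ) : ℝ) + 2 * v + 1) * θ)
          * (((n + 1 : ℕ) : ℝ) + 2 * v + 1))
        = (((n : ℝ) + 2 * v + 1 + 2 * (l + 1)) / 2) * Real.sin (((n : ℝ) + 2 * v + 1) * θ)
          - (((n : ℝ) + 2 * v + 1 - 2 * (l + 1) + 2) / 2)
            * Real.sin (((n : ℝ) + 2 * ((v + 1 : ℕ) : ℝ) + 1) * θ) := by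
      intro v
      have e1 : ((n : ℝ) + 2 * v + 1) * θ = (((n + 1 : ℕ) : ℝ) + 2 * v + 1) * θ - θ := by
        push_cast; ring
      have e2 : ((n : ℝ) + 2 * ((v + 1 : ℕ) : ℝ) + 1) * θ
          = (((n + 1 : ℕ) : ℝ) + 2 * v + 1) * θ + θ := by
        push_cast; ring
      rw [e1, e2, Real.sin_sub, Real.sin_add]
      push_cast
      ring
    have hmain : Real.sin θ ^ (2 * (l + 1) + 1) * p.derivative.eval (Real.cos θ)
        = c * ∑ v ∈ Finset.range (l + 1), alpha ((l + 1 : ℕ) : ℝ) v (n + 1) *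
          ((((n : ℝ) + 2 * v + 1 + 2 * (l + 1)) / 2) * Real.sin (((n : ℝ) + 2 * v + 1) * θ)
          - (((n : ℝ) + 2 * v + 1 - 2 * (l + 1) + 2) / 2)
            * Real.sin (((n : ℝ) + 2 * ((v + 1 : ℕ) : ℝ) + 1) * θ)) := by
      simp_rw [← htrig]
      have : ∑ v ∈ Finset.range (l + 1), alpha ((l + 1 : ℕ) : ℝ) v (n + 1) *
          ((2 * (l : ℝ) + 1) * Real.cos θ * Real.sin ((((n + 1 : ℕ) : ℝ) + 2 * v + 1) * θ)
            - Real.sin θ * (Real.cos ((((n + 1 : ℕ) : ℝ) + 2 * v + 1) * θ)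
              * (((n + 1 : ℕ) : ℝ) + 2 * v + 1)))
          = (2 * (l : ℝ) + 1) * Real.cos θ * (∑ v ∈ Finset.range (l + 1),
              alpha ((l + 1 : ℕ) : ℝ) v (n + 1) * Real.sin ((((n + 1 : ℕ) : ℝ) + 2 * v + 1) * θ))
            - Real.sin θ * ∑ v ∈ Finset.range (l + 1), alpha ((l + 1 : ℕ) : ℝ) v (n + 1) *
          (Real.cos ((((n + 1 : ℕ) : ℝ) + 2 * v + 1) * θ) * (((n + 1 : ℕ) : ℝ) + 2 * v + 1)) := by
        rw [Finset.mul_sum, Finset.mul_sum, ← Finset.sum_sub_distrib]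
        exact Finset.sum_congr rfl fun v _ => by ring
      rw [this, mul_sub, mul_left_comm, ← hθ, mul_left_comm c, ← hd]
      push_cast
      ring
    rw [hmain, Finset.sum_range_succ' _ (l + 1), mul_div_assoc, mul_assoc]
    congr 1
    have hlast : alpha ((l + 1 : ℕ) : ℝ) (l + 1) (n + 1) = 0 := alpha_self l (n + 1)
    -- Shifting the index costs no boundary term at the top, because `α_{l+1} = 0`; the bottom term
    -- is split off.
    have hshift : ∑ v ∈ Finset.range (l + 1), alpha ((l + 1 : ℕ) : ℝ) v (n + 1) *
          (((n : ℝ) + 2 * v + 1 + 2 * (l + 1)) / 2 * Real.sin (((n : ℝ) + 2 * v + 1) * θ))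
        = ∑ v ∈ Finset.range (l + 1), alpha ((l + 1 : ℕ) : ℝ) (v + 1) (n + 1) *
          (((n : ℝ) + 2 * v + 3 + 2 * (l + 1)) / 2
            * Real.sin (((n : ℝ) + 2 * ((v + 1 : ℕ) : ℝ) + 1) * θ))
          + ((n : ℝ) + 1 + 2 * (l + 1)) / 2 * Real.sin (((n : ℝ) + 1) * θ) := by
      have h1 := Finset.sum_range_succ (fun v : ℕ => alpha ((l + 1 : ℕ) : ℝ) v (n + 1) *
          (((n : ℝ) + 2 * v + 1 + 2 * (l + 1)) / 2 * Real.sin (((n : ℝ) + 2 * v + 1) * θ))) (l + 1)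
      rw [Finset.sum_range_succ', hlast, zero_mul, add_zero] at h1
      rw [← h1, alpha_zero]
      congr 1
      · refine Finset.sum_congr rfl fun v _ => ?_
        push_cast
        ring
      · simp
    simp_rw [mul_sub]
    rw [Finset.sum_sub_distrib, hshift, alpha_zero, mul_add (((n : ℝ) + 1 + 2 * (l + 1)) / 2), Finset.mul_sum, add_sub_right_comm,
      ← Finset.sum_sub_distrib]
    congr 1
    · refine Finset.sum_congr rfl fun v _ => ?_
      linear_combination (-1 / 2 : ℝ) * hsum v
    · simp

end Ultraspherical

end GegenbauerEntropy

end

noncomputable section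

namespace GegenbauerEntropy

/-! ### Zeros of Gegenbauer polynomials and the polynomial identity on the unit circle. -/

section Roots

open Polynomial Polynomial.Chebyshev

/-- The real interval `[-1, 1]`, as a subset of the complex plane. -/
def complexIcc : Set ℂ := Complex.ofRealCLM '' Set.Icc (-1 : ℝ) 1

theorem convex_complexIcc : Convex ℝ complexIcc :=
  (convex_Icc (-1 : ℝ) 1).linear_image (Complex.ofRealCLM : ℝ →ₗ[ℝ] ℂ)

/-- Writing `z = cos w` with `w` complex, `U_N(cos w) sin w = sin((N+1)w)` forces `w` to be a real
multiple of `π/(N+1)`. -/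
theorem root_U_mem_complexIcc (N : ℕ) {z : ℂ} (hz : (U ℂ (N : ℤ)).eval z = 0) :
    z ∈ complexIcc := by
  obtain ⟨w, rfl⟩ := Complex.cos_surjective z
  have h := U_complex_cos w (N : ℤ)
  rw [hz, zero_mul] at h
  obtain ⟨k, hk⟩ := Complex.sin_eq_zero_iff.mp h.symm
  have hN : ((N : ℂ) + 1) ≠ 0 := Nat.cast_add_one_ne_zero N
  have hw : w = ((k * Real.pi / (N + 1) : ℝ) : ℂ) := by
    push_cast at hk ⊢
    rw [eq_div_iff hN, ← hk, mul_comm]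
  rw [hw]
  exact ⟨Real.cos (k * Real.pi / (N + 1)), ⟨Real.neg_one_le_cos _, Real.cos_le_one _⟩, by simp⟩

/-- Gauss–Lucas at each differentiation: the zeros stay in the convex set `[-1, 1]`. -/
theorem rootSet_derivU_subset (l n : ℕ) : (derivU ℂ l n).rootSet ℂ ⊆ complexIcc := by
  induction l generalizing n with
  | zero =>
    intro z hz
    rw [mem_rootSet] at hz
    exact root_U_mem_complexIcc n (by simpa [derivU] using hz.2)
  | succ l ih =>
    rw [derivU_succ]
    refine (rootSet_derivative_subset_convexHull_rootSet ?_).trans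
      (convexHull_min (ih (n + 1)) convex_complexIcc)
    rw [← natDegree_pos_iff_degree_pos, natDegree_derivU]
    omega

/-- Factorization of the Gegenbauer polynomials over their zeros `cos φ`. -/
theorem exists_factorization_derivU (l n : ℕ) :
    ∃ (s : Multiset ℝ) (c : ℂ), s.card = n ∧ c ≠ 0 ∧ ∀ x : ℂ,
      (derivU ℂ l n).eval x = c * (s.map fun φ => x - (Real.cos φ : ℂ)).prod := by
  have hne : derivU ℂ l n ≠ 0 := by
    intro h
    have h1 := derivU_eval_one_ne_zero l n
    rw [← map_derivU] at h
    rw [Polynomial.map_eq_zero] at h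
    simp [h] at h1
  have hs : Splits (derivU ℂ l n) := IsAlgClosed.splits _
  -- The roots are kept as a multiset, so their simplicity plays no role.
  refine ⟨(derivU ℂ l n).roots.map fun z => Real.arccos z.re, (derivU ℂ l n).leadingCoeff, ?_,
    leadingCoeff_ne_zero.mpr hne, fun x => ?_⟩
  · rw [Multiset.card_map, ← hs.natDegree_eq_card_roots, natDegree_derivU]
  · conv_lhs => rw [hs.eq_prod_roots]
    rw [eval_mul, eval_C, eval_multiset_prod, Multiset.map_map, Multiset.map_map]
    congr 2
    refine Multiset.map_congr rfl fun z hz => ?_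
    have hz' : z ∈ (derivU ℂ l n).rootSet ℂ := by
      rw [mem_rootSet]
      exact ⟨hne, by simpa using (mem_roots'.mp hz).2⟩
    obtain ⟨t, ht, rfl⟩ := rootSet_derivU_subset l n hz'
    simp [-Complex.ofReal_cos, Real.cos_arccos ht.1 ht.2]

/-- The polynomial `∑ α_{l-j}/α_l X^j`. -/
def alphaRev (l n : ℕ) : ℝ[X] := ∑ v ∈ Finset.range (l + 1),
  C (alpha ((l + 1 : ℕ) : ℝ) v n / alpha ((l + 1 : ℕ) : ℝ) l n) * X ^ (l - v)

/-- The polynomial `∑ α_j/α_l X^j`. -/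
def alphaFwd (l n : ℕ) : ℝ[X] := ∑ v ∈ Finset.range (l + 1),
  C (alpha ((l + 1 : ℕ) : ℝ) v n / alpha ((l + 1 : ℕ) : ℝ) l n) * X ^ v

theorem coeff_zero_alphaRev (l n : ℕ) : (alphaRev l n).coeff 0 = 1 := by
  rw [alphaRev, Finset.sum_range_succ, coeff_add, finsetSum_coeff, Finset.sum_eq_zero]
  · rw [div_self (alpha_ne_zero n (le_refl l))]
    simp
  · intro v hv
    rw [Finset.mem_range] at hv
    rw [coeff_C_mul, coeff_X_pow, if_neg (by omega), mul_zero]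

theorem coeff_zero_alphaFwd (l n : ℕ) :
    (alphaFwd l n).coeff 0 = alpha ((l + 1 : ℕ) : ℝ) 0 n / alpha ((l + 1 : ℕ) : ℝ) l n := by
  rw [alphaFwd, Finset.sum_range_succ', coeff_add, finsetSum_coeff, Finset.sum_eq_zero]
  · simp
  · intro v hv
    rw [coeff_C_mul, coeff_X_pow, if_neg (by omega), mul_zero]

/-- The polynomial whose zeros are `e^{±iφ}`, `φ ∈ s`, with constant term `1`. -/
def unitProd (s : Multiset ℝ) : ℂ[X] :=
  (s.map fun φ : ℝ => (1 - C (Complex.exp (φ * Complex.I)) * X)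
    * (1 - C (Complex.exp (-(φ * Complex.I))) * X)).prod

/-- With `y = e^{iθ}`, each pair of factors is `1 - 2y cos φ + y² = 2y(cos θ - cos φ)`. -/
theorem eval_unitProd_exp (s : Multiset ℝ) (θ : ℝ) :
    (unitProd s).eval (Complex.exp (θ * Complex.I))
      = (2 * Complex.exp (θ * Complex.I)) ^ s.card
        * (s.map fun φ => (Real.cos θ : ℂ) - (Real.cos φ : ℂ)).prod := by
  rw [unitProd, eval_multiset_prod, Multiset.map_map]
  induction s using Multiset.induction_on with
  | empty => simp
  | cons φ s ih =>
    rw [Multiset.map_cons, Multiset.prod_cons, Multiset.map_cons, Multiset.prod_cons,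
      Multiset.card_cons, ih, Function.comp_apply]
    have h1 : Complex.exp (φ * Complex.I) * Complex.exp (-(φ * Complex.I)) = 1 := by
      rw [← Complex.exp_add]; simp
    have h2 : Complex.exp (θ * Complex.I) * Complex.exp (-(θ * Complex.I)) = 1 := by
      rw [← Complex.exp_add]; simp
    have e : eval (Complex.exp (θ * Complex.I)) ((1 - C (Complex.exp (φ * Complex.I)) * X)
        * (1 - C (Complex.exp (-(φ * Complex.I))) * X))
        = 2 * Complex.exp (θ * Complex.I) * ((Real.cos θ : ℂ) - (Real.cos φ : ℂ)) := by
      simp only [eval_mul, eval_sub, eval_one, eval_C, eval_X, Complex.ofReal_cos, Complex.cos,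
        neg_mul]
      linear_combination Complex.exp (θ * Complex.I) ^ 2 * h1 - h2
    rw [e]
    ring

theorem two_I_mul_sin_mul_exp (k : ℕ) (θ : ℝ) :
    2 * Complex.I * (Real.sin (k * θ) : ℂ) * Complex.exp (θ * Complex.I) ^ k
      = Complex.exp (θ * Complex.I) ^ (2 * k) - 1 := by
  have h2 : Complex.exp (k * θ * Complex.I) * Complex.exp (-(k * θ * Complex.I)) = 1 := by
    rw [← Complex.exp_add]; simp
  have h3 : Complex.exp (θ * Complex.I) ^ k = Complex.exp (k * θ * Complex.I) := by
    rw [← Complex.exp_nat_mul, mul_assoc]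
  rw [mul_comm 2 k, pow_mul, h3, Complex.ofReal_sin, Complex.sin]
  push_cast
  rw [neg_mul]
  linear_combination (Complex.exp (k * θ * Complex.I) * (Complex.exp (-(k * θ * Complex.I))
    - Complex.exp (k * θ * Complex.I))) * Complex.I_sq - h2

theorem eq_of_eval_exp_eq {p q : ℂ[X]}
    (h : ∀ θ : ℝ, p.eval (Complex.exp (θ * Complex.I)) = q.eval (Complex.exp (θ * Complex.I))) :
    p = q := by
  refine eq_of_infinite_eval_eq p q ?_
  refine Set.infinite_of_injOn_mapsTo (f := fun θ : ℝ => Complex.exp (θ * Complex.I))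
    (s := Set.Ioo (-Real.pi) Real.pi) ?_ (fun θ _ => h θ) (Set.Ioo_infinite (by linarith [Real.pi_pos]))
  intro a ha b hb hab
  have := Complex.exp_inj_of_neg_pi_lt_of_le_pi (by simpa using ha.1) (by simpa using ha.2.le)
    (by simpa using hb.1) (by simpa using hb.2.le) hab
  simpa using this

/-- At `X = y = e^{iθ}` both sides are multiples of `y^{n+2l+1} sin^{2l+1}θ · C_n(cos θ)`, read once
through the zeros and once through the sine expansion. The power of `y` turns every sine into a
polynomial in `y²`. -/
theorem one_sub_sq_pow_mul_unitProd {l n : ℕ} {s : Multiset ℝ} {c : ℂ} (hs : s.card = n)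
    (hc : c ≠ 0) (h : ∀ x : ℂ,
      (derivU ℂ l n).eval x = c * (s.map fun φ => x - (Real.cos φ : ℂ)).prod) :
    expand ℂ 2 (1 - X) ^ (2 * l + 1) * unitProd s
      = expand ℂ 2 ((alphaRev l n).map (algebraMap ℝ ℂ)
        - X ^ (n + l + 1) * (alphaFwd l n).map (algebraMap ℝ ℂ)) := by
  obtain ⟨c', hc'⟩ := sin_pow_mul_derivU l n
  have hα : (alpha ((l + 1 : ℕ) : ℝ) l n : ℂ) ≠ 0 := by
    exact_mod_cast alpha_ne_zero n (le_refl l)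
  obtain ⟨K, hK⟩ : ∃ K : ℂ, expand ℂ 2 (1 - X) ^ (2 * l + 1) * unitProd s
      = C K * expand ℂ 2 ((alphaRev l n).map (algebraMap ℝ ℂ)
        - X ^ (n + l + 1) * (alphaFwd l n).map (algebraMap ℝ ℂ)) := by
    -- The factors come, in order, from `1 - y² = -2i y sin θ`, from `(2y)^n` in
    -- `eval_unitProd_exp`, from the factorization and the sine expansion, from `2i sin`, and from
    -- the division by `α_l`.
    refine ⟨(-2 * Complex.I) ^ (2 * l + 1) * 2 ^ n * c⁻¹ * c' * (-1 / (2 * Complex.I))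
      * (alpha ((l + 1 : ℕ) : ℝ) l n : ℂ), eq_of_eval_exp_eq fun θ => ?_⟩
    have hθ : (Real.sin θ : ℂ) ^ (2 * l + 1) * (derivU ℂ l n).eval (Real.cos θ : ℂ)
        = c' * ∑ v ∈ Finset.range (l + 1), (alpha ((l + 1 : ℕ) : ℝ) v n : ℂ)
          * (Real.sin (((n : ℝ) + 2 * v + 1) * θ) : ℂ) := by
      have := congrArg (fun t : ℝ => (t : ℂ)) (hc' θ)
      rw [← map_derivU]
      rw [show ((Real.cos θ : ℝ) : ℂ) = algebraMap ℝ ℂ (Real.cos θ) from rfl, eval_map_apply]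
      simp only [Complex.coe_algebraMap]
      simpa only [Complex.ofReal_mul, Complex.ofReal_pow, Complex.ofReal_sum] using this
    have h1 := two_I_mul_sin_mul_exp 1 θ
    have hsin := fun v => two_I_mul_sin_mul_exp (n + 2 * v + 1) θ
    rw [h] at hθ
    rw [eval_mul, eval_pow, expand_eval, eval_unitProd_exp, hs, eval_C_mul, expand_eval]
    set y := Complex.exp (θ * Complex.I) with hy
    simp only [Nat.cast_one, one_mul, pow_one, mul_one] at h1
    have h2 : eval (y ^ 2) (1 - X : ℂ[X]) = -2 * Complex.I * y * (Real.sin θ : ℂ) := by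
      simp only [eval_sub, eval_one, eval_X]
      linear_combination h1
    have h3 : ∀ v ∈ Finset.range (l + 1),
        (alpha ((l + 1 : ℕ) : ℝ) v n : ℂ) * (Real.sin (((n : ℝ) + 2 * v + 1) * θ) : ℂ)
          * y ^ (n + 2 * l + 1) * (2 * Complex.I)
        = (alpha ((l + 1 : ℕ) : ℝ) v n : ℂ) *
          ((y ^ 2) ^ (n + l + 1) * (y ^ 2) ^ v - (y ^ 2) ^ (l - v)) := by
      intro v hv
      obtain ⟨j, hj⟩ : ∃ j, l = v + j := ⟨l - v, by rw [Finset.mem_range] at hv; omega⟩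
      have := hsin v
      push_cast at this
      have e1 : y ^ (n + 2 * l + 1) = y ^ (n + 2 * v + 1) * (y ^ 2) ^ j := by rw [hj]; ring
      have e2 : (y ^ 2) ^ (n + l + 1) * (y ^ 2) ^ v = y ^ (2 * (n + 2 * v + 1)) * (y ^ 2) ^ j := by
        rw [hj]; ring
      rw [e1, e2, show l - v = j by omega]
      rw [Complex.ofReal_sin]
      push_cast [-Nat.cast_add, -Nat.cast_succ]
      linear_combination ((alpha ((l + 1 : ℕ) : ℝ) v n : ℂ) * (y ^ 2) ^ j) * this
    have h4 : (∑ v ∈ Finset.range (l + 1), (alpha ((l + 1 : ℕ) : ℝ) v n : ℂ)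
          * (Real.sin (((n : ℝ) + 2 * v + 1) * θ) : ℂ)) * y ^ (n + 2 * l + 1) * (2 * Complex.I)
        = -(alpha ((l + 1 : ℕ) : ℝ) l n : ℂ) * eval (y ^ 2) ((alphaRev l n).map (algebraMap ℝ ℂ)
        - X ^ (n + l + 1) * (alphaFwd l n).map (algebraMap ℝ ℂ)) := by
      rw [Finset.sum_mul, Finset.sum_mul, Finset.sum_congr rfl h3]
      simp only [alphaRev, alphaFwd, Polynomial.map_sum, Polynomial.map_mul, Polynomial.map_pow,
        Polynomial.map_C, map_X, eval_sub, eval_mul, eval_pow, eval_X, eval_finsetSum, eval_C,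
        Complex.coe_algebraMap, Complex.ofReal_div]
      rw [Finset.mul_sum, ← Finset.sum_sub_distrib, Finset.mul_sum]
      refine Finset.sum_congr rfl fun v _ => ?_
      field_simp
      ring
    have h5 : (Real.sin θ : ℂ) ^ (2 * l + 1)
        * (s.map fun φ => (Real.cos θ : ℂ) - (Real.cos φ : ℂ)).prod
        = c⁻¹ * (c' * ∑ v ∈ Finset.range (l + 1), (alpha ((l + 1 : ℕ) : ℝ) v n : ℂ)
          * (Real.sin (((n : ℝ) + 2 * v + 1) * θ) : ℂ)) := by
      rw [← hθ]
      field_simp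
    rw [h2]
    have hI : (2 * Complex.I)⁻¹ * (2 * Complex.I) = 1 :=
      inv_mul_cancel₀ (by simp)
    generalize eval (y ^ 2) ((alphaRev l n).map (algebraMap ℝ ℂ)
        - X ^ (n + l + 1) * (alphaFwd l n).map (algebraMap ℝ ℂ)) = W at *
    generalize (s.map fun φ => (Real.cos θ : ℂ) - (Real.cos φ : ℂ)).prod = V at *
    generalize (∑ v ∈ Finset.range (l + 1), (alpha ((l + 1 : ℕ) : ℝ) v n : ℂ)
          * (Real.sin (((n : ℝ) + 2 * v + 1) * θ) : ℂ)) = T at *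
    calc (-2 * Complex.I * y * (Real.sin θ : ℂ)) ^ (2 * l + 1) * ((2 * y) ^ n * V)
        = (-2 * Complex.I) ^ (2 * l + 1) * 2 ^ n * y ^ (n + 2 * l + 1)
          * ((Real.sin θ : ℂ) ^ (2 * l + 1) * V) := by
          rw [mul_pow, mul_pow, mul_pow 2 y]; ring
      _ = (-2 * Complex.I) ^ (2 * l + 1) * 2 ^ n * c⁻¹ * c' * (2 * Complex.I)⁻¹
          * (T * y ^ (n + 2 * l + 1) * (2 * Complex.I)) := by
          rw [h5]
          linear_combination (-(-2 * Complex.I) ^ (2 * l + 1) * 2 ^ n * c⁻¹ * c' * T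
            * y ^ (n + 2 * l + 1)) * hI
      _ = _ := by rw [h4]; ring
  -- Evaluation at 0 fixes the scalar, both polynomials having constant term 1; `c` and `c'` need
  -- not be computed.
  have hK1 : K = 1 := by
    have := congrArg (eval 0) hK
    rw [eval_mul, eval_pow, expand_eval, eval_C_mul, expand_eval, unitProd, eval_multiset_prod,
      Multiset.map_map] at this
    have e1 : (s.map (eval 0 ∘ fun φ : ℝ => (1 - C (Complex.exp (φ * Complex.I)) * X)
        * (1 - C (Complex.exp (-(φ * Complex.I))) * X))).prod = 1 := by
      simp
    rw [e1] at this
    have e2 : eval (0 ^ 2 : ℂ) ((alphaRev l n).map (algebraMap ℝ ℂ)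
        - X ^ (n + l + 1) * (alphaFwd l n).map (algebraMap ℝ ℂ)) = 1 := by
      rw [zero_pow two_ne_zero, ← coeff_zero_eq_eval_zero, coeff_sub, mul_coeff_zero,
        coeff_X_pow, if_neg (by omega), coeff_map, coeff_zero_alphaRev]
      simp
    rw [e2] at this
    simpa using this.symm
  rw [hK, hK1, C_1, one_mul]

theorem logCoeff_map {K L : Type*} [Field K] [Field L] (f : K →+* L) (F : PowerSeries K) (m : ℕ) :
    logCoeff (PowerSeries.map f F) m = f (logCoeff F m) := by
  rw [logCoeff, logCoeff, map_sum]
  refine Finset.sum_congr rfl fun k _ => ?_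
  rw [map_mul, ← PowerSeries.coeff_map]
  simp

/-- Each conjugate pair contributes `-(e^{2imφ} + e^{-2imφ})/(2m)`. -/
theorem logCoeff_unitProd (s : Multiset ℝ) {m : ℕ} (hm : 1 ≤ m) :
    logCoeff (unitProd s : PowerSeries ℂ) (2 * m)
      = ((-(s.map fun φ => Real.cos (2 * m * φ)).sum / m : ℝ) : ℂ) := by
  have e : (unitProd s : PowerSeries ℂ) = (s.map fun φ : ℝ =>
      (1 - PowerSeries.C (Complex.exp (φ * Complex.I)) * PowerSeries.X)
        * (1 - PowerSeries.C (Complex.exp (-(φ * Complex.I))) * PowerSeries.X)).prod := by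
    rw [unitProd, ← coeToPowerSeries.ringHom_apply, map_multiset_prod, Multiset.map_map]
    simp [Function.comp_def]
  rw [e, logCoeff_multiset_prod _ _ (by simp)]
  have hm0 : (m : ℂ) ≠ 0 := by exact_mod_cast (show m ≠ 0 by omega)
  have e2 : ∀ φ : ℝ, logCoeff ((1 - PowerSeries.C (Complex.exp (φ * Complex.I)) * PowerSeries.X)
        * (1 - PowerSeries.C (Complex.exp (-(φ * Complex.I))) * PowerSeries.X)) (2 * m)
        = ((-1 / m * Real.cos (2 * m * φ) : ℝ) : ℂ) := by
    intro φ
    rw [logCoeff_mul (by simp) (by simp), logCoeff_one_sub_C_mul_X _ (by omega),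
      logCoeff_one_sub_C_mul_X _ (by omega), ← Complex.exp_nat_mul, ← Complex.exp_nat_mul]
    push_cast
    rw [Complex.cos]
    field_simp
    ring_nf
  simp only [e2]
  clear e
  induction s using Multiset.induction_on with
  | empty => simp
  | cons φ s ih =>
    simp only [Multiset.map_cons, Multiset.sum_cons]
    rw [ih]
    push_cast
    ring

/-- Obtained by comparing the coefficients of `X^{2m}` in the logarithms of the two sides of
`one_sub_sq_pow_mul_unitProd`. -/
theorem sum_cos_eq_logCoeff {l n m : ℕ} {s : Multiset ℝ} {c : ℂ} (hs : s.card = n)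
    (hc : c ≠ 0) (h : ∀ x : ℂ,
      (derivU ℂ l n).eval x = c * (s.map fun φ => x - (Real.cos φ : ℂ)).prod)
    (hm : 1 ≤ m) (hmn : m ≤ n + l + 1) :
    -(s.map fun φ => Real.cos (2 * m * φ)).sum / m
      = (2 * l + 1) / m + logCoeff (alphaRev l n : PowerSeries ℝ) m
        - (if m = n + l + 1 then alpha ((l + 1 : ℕ) : ℝ) 0 n / alpha ((l + 1 : ℕ) : ℝ) l n
            else 0) := by
  have key := congrArg (fun p : ℂ[X] => logCoeff (p : PowerSeries ℂ) (2 * m))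
    (one_sub_sq_pow_mul_unitProd hs hc h)
  have c1 : PowerSeries.constantCoeff (unitProd s : PowerSeries ℂ) = 1 := by
    rw [constantCoeff_coe, coeff_zero_eq_eval_zero, unitProd, eval_multiset_prod, Multiset.map_map]
    simp
  have c2 : PowerSeries.constantCoeff ((expand ℂ 2 (1 - X) : ℂ[X]) : PowerSeries ℂ) = 1 := by
    simp
  have c3 : PowerSeries.constantCoeff
      ((alphaRev l n).map (algebraMap ℝ ℂ) : PowerSeries ℂ) = 1 := by
    rw [constantCoeff_coe, coeff_map, coeff_zero_alphaRev, map_one]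
  simp only [coe_mul, coe_pow] at key
  rw [logCoeff_mul (by simp) c1, logCoeff_pow c2, logCoeff_unitProd s hm,
    logCoeff_expand_two (by simp), logCoeff_expand_two] at key
  · have e1 : ((1 - X : ℂ[X]) : PowerSeries ℂ) = 1 - PowerSeries.C 1 * PowerSeries.X := by simp
    rw [e1, logCoeff_one_sub_C_mul_X _ hm, coe_sub, coe_mul, coe_pow, coe_X,
      logCoeff_sub_X_pow_mul c3 _ hm hmn, constantCoeff_coe, coeff_map, coeff_zero_alphaFwd,
      polynomial_map_coe, logCoeff_map] at key
    rw [← Complex.ofReal_inj]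
    have : (((if m = n + l + 1 then alpha ((l + 1 : ℕ) : ℝ) 0 n / alpha ((l + 1 : ℕ) : ℝ) l n
            else 0) : ℝ) : ℂ) = if m = n + l + 1 then algebraMap ℝ ℂ
              (alpha ((l + 1 : ℕ) : ℝ) 0 n / alpha ((l + 1 : ℕ) : ℝ) l n) else 0 := by
      split_ifs <;> simp
    rw [Complex.ofReal_sub, this, Complex.ofReal_add]
    simp only [Complex.coe_algebraMap] at key ⊢
    rw [add_sub_assoc, ← key]
    push_cast
    ring
  · rw [coeff_sub, mul_coeff_zero, coeff_X_pow, if_neg (by omega), coeff_map, coeff_zero_alphaRev]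
    simp

end Roots

end GegenbauerEntropy

end

noncomputable section

namespace GegenbauerEntropy

/-! ### Fourier coefficients of logarithms of moduli, and the integral as a power sum over the
zeros. -/

section LogIntegral

open MeasureTheory Complex

theorem integral_exp_int_mul (j : ℤ) :
    ∫ θ in (0 : ℝ)..2 * Real.pi, cexp (j * I * θ) = if j = 0 then 2 * (Real.pi : ℂ) else 0 := by
  split_ifs with h
  · simp [h]
  · have hj : (j : ℂ) * I ≠ 0 := by simp [h]
    rw [integral_exp_mul_complex hj]
    have : cexp (j * I * ((2 * Real.pi : ℝ) : ℂ)) = 1 := by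
      rw [exp_eq_one_iff]; exact ⟨j, by push_cast; ring⟩
    rw [this]
    simp

theorem integral_cos_mul_exp_pow {m : ℕ} (hm : 1 ≤ m) (k : ℕ) :
    ∫ θ in (0 : ℝ)..2 * Real.pi, (Real.cos (m * θ) : ℂ) * cexp (θ * I) ^ k
      = if k = m then (Real.pi : ℂ) else 0 := by
  have e : ∀ θ : ℝ, (Real.cos (m * θ) : ℂ) * cexp (θ * I) ^ k
      = (1 / 2) * cexp (((k + m : ℤ) : ℂ) * I * θ) + (1 / 2) * cexp (((k - m : ℤ) : ℂ) * I * θ) := by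
    intro θ
    rw [ofReal_cos, Complex.cos, ← exp_nat_mul]
    push_cast
    rw [show ((k : ℂ) + m) * I * θ = k * (θ * I) + m * θ * I by ring,
      show ((k : ℂ) - m) * I * θ = k * (θ * I) + -(m * θ) * I by ring, exp_add, exp_add]
    ring
  simp_rw [e]
  rw [intervalIntegral.integral_add, intervalIntegral.integral_const_mul,
    intervalIntegral.integral_const_mul, integral_exp_int_mul, integral_exp_int_mul,
    if_neg (by omega)]
  · by_cases h : k = m
    · rw [if_pos (by omega), if_pos h]; ring
    · rw [if_neg (by omega), if_neg h]; ring
  · exact Continuous.intervalIntegrable (by fun_prop) _ _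
  · exact Continuous.intervalIntegrable (by fun_prop) _ _

/-- The Fourier coefficients of `log ‖1 - u e^{iθ}‖` for `‖u‖ < 1`. -/
theorem integral_cos_mul_log_norm_of_lt {u : ℂ} (hu : ‖u‖ < 1) {m : ℕ} (hm : 1 ≤ m) :
    ∫ θ in (0 : ℝ)..2 * Real.pi, Real.cos (m * θ) * Real.log ‖1 - u * cexp (θ * I)‖
      = -(Real.pi / m) * (u ^ m).re := by
  have hnorm : ∀ θ : ℝ, ‖u * cexp (θ * I)‖ = ‖u‖ := fun θ => by
    rw [norm_mul, norm_exp_ofReal_mul_I, mul_one]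
  have hsum : HasSum (fun k : ℕ => ∫ θ in (0 : ℝ)..2 * Real.pi,
        (Real.cos (m * θ) : ℂ) * ((u * cexp (θ * I)) ^ k / k))
      (∫ θ in (0 : ℝ)..2 * Real.pi, (Real.cos (m * θ) : ℂ) * (-log (1 - u * cexp (θ * I)))) := by
    -- Termwise integration of `-log(1 - z) = ∑ z^k/k`, dominated by a geometric series. The term `k
    -- = 0` vanishes because division by 0 gives 0.
    refine intervalIntegral.hasSum_integral_of_dominated_convergence (fun k _ => ‖u‖ ^ k)
      (fun k => ?_) (fun k => ?_) ?_ ?_ ?_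
    · exact Continuous.aestronglyMeasurable (by fun_prop)
    · refine Filter.Eventually.of_forall fun θ _ => ?_
      rw [norm_mul, norm_div, norm_pow, hnorm, norm_real, norm_natCast]
      have h1 : ‖Real.cos (m * θ)‖ ≤ 1 := Real.abs_cos_le_one _
      have h2 : ‖u‖ ^ k / k ≤ ‖u‖ ^ k := by
        rcases Nat.eq_zero_or_pos k with rfl | hk
        · simp
        · exact div_le_self (by positivity) (by exact_mod_cast hk)
      calc _ ≤ 1 * (‖u‖ ^ k) := mul_le_mul h1 h2 (by positivity) zero_le_one
        _ = _ := one_mul _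
    · exact Filter.Eventually.of_forall fun _ _ =>
        summable_geometric_of_lt_one (norm_nonneg _) hu
    · exact intervalIntegrable_const
    · refine Filter.Eventually.of_forall fun θ _ => ?_
      exact (hasSum_taylorSeries_neg_log (by rw [hnorm]; exact hu)).mul_left _
  have hterm : ∀ k : ℕ, ∫ θ in (0 : ℝ)..2 * Real.pi,
        (Real.cos (m * θ) : ℂ) * ((u * cexp (θ * I)) ^ k / k)
      = if k = m then u ^ m / m * Real.pi else 0 := by
    intro k
    have e : ∀ θ : ℝ, (Real.cos (m * θ) : ℂ) * ((u * cexp (θ * I)) ^ k / k)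
        = u ^ k / k * ((Real.cos (m * θ) : ℂ) * cexp (θ * I) ^ k) := fun θ => by
      rw [mul_pow]; ring
    simp_rw [e]
    rw [intervalIntegral.integral_const_mul, integral_cos_mul_exp_pow hm]
    split_ifs with h
    · rw [h]
    · simp
  simp_rw [hterm] at hsum
  have hval := hsum.unique (hasSum_ite_eq m (u ^ m / m * (Real.pi : ℂ)))
  have hslit : ∀ θ : ℝ, 1 - u * cexp (θ * I) ∈ slitPlane := by
    intro θ
    refine Or.inl ?_
    have := (abs_le.mp (abs_re_le_norm (u * cexp (θ * I)))).2
    rw [hnorm] at this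
    rw [sub_re, one_re]
    linarith
  have hint : IntervalIntegrable (fun θ : ℝ => (Real.cos (m * θ) : ℂ)
      * (-log (1 - u * cexp (θ * I)))) volume 0 (2 * Real.pi) := by
    refine Continuous.intervalIntegrable ?_ _ _
    refine Continuous.mul (by fun_prop) (Continuous.neg ?_)
    exact Continuous.clog (by fun_prop) hslit
  have hre := intervalIntegral.intervalIntegral_re hint
  rw [hval] at hre
  have e : ∀ θ : ℝ, Real.cos (m * θ) * Real.log ‖1 - u * cexp (θ * I)‖
      = -RCLike.re ((Real.cos (m * θ) : ℂ) * (-log (1 - u * cexp (θ * I)))) := by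
    intro θ
    rw [RCLike.re_eq_complex_re, re_ofReal_mul, neg_re, log_re]
    ring
  simp_rw [e]
  rw [intervalIntegral.integral_neg, hre, RCLike.re_eq_complex_re,
    show u ^ m / m * (Real.pi : ℂ) = ((Real.pi / m : ℝ) : ℂ) * u ^ m by push_cast; ring,
    re_ofReal_mul]
  ring

theorem intervalIntegrable_log_norm_one_sub (u : ℂ) (a b : ℝ) :
    IntervalIntegrable (fun θ : ℝ => Real.log ‖1 - u * cexp (θ * I)‖) volume a b := by
  refine MeromorphicOn.intervalIntegrable_log_norm fun x _ => AnalyticAt.meromorphicAt ?_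
  have h : AnalyticAt ℂ (fun z : ℂ => 1 - u * cexp (z * I)) x := by fun_prop
  exact h.restrictScalars.comp (ofRealCLM.analyticAt x)

theorem ae_one_sub_ne_zero (φ : ℝ) :
    ∀ᵐ θ : ℝ, 1 - cexp (φ * I) * cexp (θ * I) ≠ 0 := by
  have hc : (Set.range fun k : ℤ => (k : ℝ) * (2 * Real.pi) - φ).Countable :=
    Set.countable_range _
  filter_upwards [hc.ae_notMem volume] with θ hθ h
  refine hθ ?_
  rw [sub_eq_zero, ← exp_add, eq_comm, exp_eq_one_iff] at h
  obtain ⟨k, hk⟩ := h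
  refine ⟨k, ?_⟩
  have h1 : ((φ : ℂ) + θ) * I = ((k : ℂ) * (2 * Real.pi)) * I := by linear_combination hk
  have h2 := mul_right_cancel₀ I_ne_zero h1
  have h3 : φ + θ = k * (2 * Real.pi) := by exact_mod_cast h2
  simp only
  linarith

/-- The Fourier coefficients of `log ‖1 - e^{iφ} e^{iθ}‖`. -/
theorem integral_cos_mul_log_norm (φ : ℝ) {m : ℕ} (hm : 1 ≤ m) :
    ∫ θ in (0 : ℝ)..2 * Real.pi, Real.cos (m * θ) * Real.log ‖1 - cexp (φ * I) * cexp (θ * I)‖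
      = -(Real.pi / m) * Real.cos (m * φ) := by
  set u := cexp (φ * I) with hu
  have hun : ‖u‖ = 1 := norm_exp_ofReal_mul_I φ
  -- The boundary case is the limit `r → 1⁻` of the case `‖ru‖ < 1`.
  have hlim : Filter.Tendsto (fun r : ℝ => ∫ θ in (0 : ℝ)..2 * Real.pi,
      Real.cos (m * θ) * Real.log ‖1 - (r * u) * cexp (θ * I)‖) (nhdsWithin 1 (Set.Ioo 0 1))
      (nhds (∫ θ in (0 : ℝ)..2 * Real.pi,
        Real.cos (m * θ) * Real.log ‖1 - u * cexp (θ * I)‖)) := by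
    refine intervalIntegral.tendsto_integral_filter_of_dominated_convergence
      (fun θ => |Real.log ‖1 - u * cexp (θ * I)‖| + Real.log 2) ?_ ?_ ?_ ?_
    · refine Filter.Eventually.of_forall fun r => ?_
      refine AEStronglyMeasurable.mul (Continuous.aestronglyMeasurable (by fun_prop)) ?_
      exact ((Real.measurable_log.comp (by fun_prop)).aestronglyMeasurable)
    · filter_upwards [self_mem_nhdsWithin] with r hr
      filter_upwards [ae_one_sub_ne_zero φ] with θ hθ _
      have hw : ‖u * cexp (θ * I)‖ = 1 := by rw [norm_mul, hun, norm_exp_ofReal_mul_I, one_mul]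
      rw [mul_assoc]
      generalize u * cexp (θ * I) = w at hw hθ ⊢
      have hd : 0 < ‖1 - w‖ := norm_pos_iff.mpr hθ
      have hrw : ‖(r : ℂ) * w‖ = r := by
        rw [norm_mul, hw, norm_real, mul_one, Real.norm_of_nonneg hr.1.le]
      -- For `‖w‖ = 1` this yields `‖1 - w‖ ≤ 2‖1 - rw‖` for every `r`, hence a majorant independent
      -- of `r`.
      have h1 : 1 - r ≤ ‖1 - r * w‖ := by
        have := norm_sub_norm_le 1 ((r : ℂ) * w)
        rwa [hrw, norm_one] at this
      have h2 : ‖1 - w‖ ≤ ‖1 - r * w‖ + (1 - r) := by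
        have h3 : (1 : ℂ) - w = (1 - r * w) - ((1 - r : ℝ) : ℂ) * w := by push_cast; ring
        have h4 := norm_sub_le (1 - r * w) (((1 - r : ℝ) : ℂ) * w)
        rwa [← h3, norm_mul, hw, norm_real, mul_one, Real.norm_of_nonneg (by linarith [hr.2])] at h4
      have h5 : ‖1 - r * w‖ ≤ 2 := by
        have := norm_sub_le 1 ((r : ℂ) * w)
        rw [hrw, norm_one] at this
        linarith [hr.2]
      have h6 : 0 < ‖1 - r * w‖ := by linarith [hr.2]
      have h7 : Real.log ‖1 - r * w‖ ≤ Real.log 2 := Real.log_le_log h6 h5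
      have h8 : Real.log ‖1 - w‖ ≤ Real.log 2 + Real.log ‖1 - r * w‖ := by
        rw [← Real.log_mul two_ne_zero h6.ne']
        exact Real.log_le_log hd (by linarith)
      have h9 : |Real.log ‖1 - r * w‖| ≤ |Real.log ‖1 - w‖| + Real.log 2 := by
        have h10 := neg_abs_le (Real.log ‖1 - w‖)
        have h11 := abs_nonneg (Real.log ‖1 - w‖)
        rw [abs_le]
        constructor <;> linarith
      rw [norm_mul, Real.norm_eq_abs, Real.norm_eq_abs]
      calc _ ≤ 1 * |Real.log ‖1 - r * w‖| :=
            mul_le_mul_of_nonneg_right (Real.abs_cos_le_one _) (abs_nonneg _)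
        _ ≤ _ := by rw [one_mul]; exact h9
    · exact (intervalIntegrable_log_norm_one_sub u _ _).abs.add intervalIntegrable_const
    · filter_upwards [ae_one_sub_ne_zero φ] with θ hθ _
      refine Filter.Tendsto.mono_left ?_ nhdsWithin_le_nhds
      have hcont : ContinuousAt (fun r : ℝ => Real.cos (m * θ)
          * Real.log ‖1 - (r * u) * cexp (θ * I)‖) 1 := by
        refine ContinuousAt.mul continuousAt_const (ContinuousAt.log (by fun_prop) ?_)
        simpa using hθ
      simpa [ContinuousAt] using hcont
  have hlim2 : Filter.Tendsto (fun r : ℝ => -(Real.pi / m) * (((r : ℂ) * u) ^ m).re)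
      (nhdsWithin 1 (Set.Ioo 0 1)) (nhds (-(Real.pi / m) * (u ^ m).re)) := by
    refine Filter.Tendsto.mono_left ?_ nhdsWithin_le_nhds
    have hcont : Continuous (fun r : ℝ => -(Real.pi / m) * (((r : ℂ) * u) ^ m).re) := by fun_prop
    simpa using hcont.tendsto 1
  have hne : (nhdsWithin (1 : ℝ) (Set.Ioo 0 1)).NeBot := right_nhdsWithin_Ioo_neBot zero_lt_one
  have heq := tendsto_nhds_unique_of_eventuallyEq hlim hlim2 (by
    filter_upwards [self_mem_nhdsWithin] with r hr
    refine integral_cos_mul_log_norm_of_lt ?_ hm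
    rw [norm_mul, hun, norm_real, mul_one, Real.norm_of_nonneg hr.1.le]
    exact hr.2)
  rw [heq, hu, ← exp_nat_mul, show (m : ℂ) * (φ * I) = ((m * φ : ℝ) : ℂ) * I by push_cast; ring,
    exp_ofReal_mul_I_re]

/-- The sum of the logarithms of the moduli of the factors of `unitProd s`. -/
def logSum (s : Multiset ℝ) (θ : ℝ) : ℝ :=
  (s.map fun φ : ℝ => Real.log ‖1 - cexp (φ * I) * cexp (θ * I)‖
    + Real.log ‖1 - cexp ((-φ : ℝ) * I) * cexp (θ * I)‖).sum

theorem intervalIntegrable_logSum (s : Multiset ℝ) (a b : ℝ) :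
    IntervalIntegrable (logSum s) volume a b := by
  induction s using Multiset.induction_on with
  | empty =>
    have : logSum 0 = fun _ => 0 := by funext θ; simp [logSum]
    rw [this]
    exact intervalIntegrable_const
  | cons φ s ih =>
    have : logSum (φ ::ₘ s) = fun θ : ℝ => (Real.log ‖1 - cexp (φ * I) * cexp (θ * I)‖
        + Real.log ‖1 - cexp ((-φ : ℝ) * I) * cexp (θ * I)‖) + logSum s θ := by
      funext θ; simp [logSum]
    rw [this]
    exact ((intervalIntegrable_log_norm_one_sub _ _ _).add
      (intervalIntegrable_log_norm_one_sub _ _ _)).add ih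

theorem integral_cos_mul_logSum (s : Multiset ℝ) {m : ℕ} (hm : 1 ≤ m) :
    ∫ θ in (0 : ℝ)..2 * Real.pi, Real.cos (m * θ) * logSum s θ
      = -(2 * Real.pi / m) * (s.map fun φ => Real.cos (m * φ)).sum := by
  have hcos : ContinuousOn (fun θ : ℝ => Real.cos (m * θ)) (Set.uIcc 0 (2 * Real.pi)) :=
    Continuous.continuousOn (by fun_prop)
  induction s using Multiset.induction_on with
  | empty => simp [logSum]
  | cons φ s ih =>
    have : ∀ θ, Real.cos (m * θ) * logSum (φ ::ₘ s) θ
        = (Real.cos (m * θ) * Real.log ‖1 - cexp (φ * I) * cexp (θ * I)‖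
        + Real.cos (m * θ) * Real.log ‖1 - cexp ((-φ : ℝ) * I) * cexp (θ * I)‖)
          + Real.cos (m * θ) * logSum s θ := by
      intro θ; simp only [logSum, Multiset.map_cons, Multiset.sum_cons]; ring
    simp_rw [this]
    have i1 := (intervalIntegrable_log_norm_one_sub (cexp (φ * I)) 0 (2 * Real.pi)).continuousOn_mul
      hcos
    have i2 := (intervalIntegrable_log_norm_one_sub (cexp ((-φ : ℝ) * I)) 0
      (2 * Real.pi)).continuousOn_mul hcos
    have i3 := (intervalIntegrable_logSum s 0 (2 * Real.pi)).continuousOn_mul hcos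
    rw [intervalIntegral.integral_add (i1.add i2) i3, intervalIntegral.integral_add i1 i2, ih,
      integral_cos_mul_log_norm φ hm, integral_cos_mul_log_norm (-φ) hm, Multiset.map_cons,
      Multiset.sum_cons, mul_neg, Real.cos_neg]
    ring

/-- Only almost everywhere: with `Real.log 0 = 0`, additivity can fail where a factor vanishes. -/
theorem ae_log_norm_unitProd (s : Multiset ℝ) :
    ∀ᵐ θ : ℝ, (unitProd s).eval (cexp (θ * I)) ≠ 0 ∧
      Real.log ‖(unitProd s).eval (cexp (θ * I))‖ = logSum s θ := by
  induction s using Multiset.induction_on with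
  | empty => simp [unitProd, logSum]
  | cons φ s ih =>
    filter_upwards [ih, ae_one_sub_ne_zero φ, ae_one_sub_ne_zero (-φ)] with θ h1 h2 h3
    have e : (unitProd (φ ::ₘ s)).eval (cexp (θ * I)) = (1 - cexp (φ * I) * cexp (θ * I))
        * (1 - cexp ((-φ : ℝ) * I) * cexp (θ * I)) * (unitProd s).eval (cexp (θ * I)) := by
      simp [unitProd]
    rw [e]
    refine ⟨mul_ne_zero (mul_ne_zero h2 h3) h1.1, ?_⟩
    rw [norm_mul, norm_mul, Real.log_mul (mul_ne_zero (norm_ne_zero_iff.mpr h2)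
      (norm_ne_zero_iff.mpr h3)) (norm_ne_zero_iff.mpr h1.1),
      Real.log_mul (norm_ne_zero_iff.mpr h2) (norm_ne_zero_iff.mpr h3), h1.2]
    simp [logSum]

theorem intervalIntegrable_integrandI (l n m : ℕ) (a b : ℝ) :
    IntervalIntegrable (integrandI ((l + 1 : ℕ) : ℝ) m n) volume a b := by
  obtain ⟨c, _, hc⟩ := gegenbauer_eq_const_mul_derivU l n
  have h : IntervalIntegrable
      (fun θ => Real.log (gegenbauer ((l + 1 : ℕ) : ℝ) n (Real.cos θ) ^ 2)) volume a b := by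
    refine MeromorphicOn.intervalIntegrable_log fun x _ => AnalyticAt.meromorphicAt ?_
    simp_rw [hc]
    have := (AnalyticOnNhd.eval_polynomial (𝕜 := ℝ) (derivU ℝ l n)) (Real.cos x) trivial
    fun_prop
  exact h.continuousOn_mul (Continuous.continuousOn (by fun_prop))

theorem integralI_eq_sum_cos {l n m : ℕ} {s : Multiset ℝ} {c : ℂ} (hs : s.card = n)
    (hc : c ≠ 0) (h : ∀ x : ℂ,
      (derivU ℂ l n).eval x = c * (s.map fun φ => x - (Real.cos φ : ℂ)).prod) (hm : 1 ≤ m) :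
    integralI ((l + 1 : ℕ) : ℝ) m n
      = Real.pi * (-(s.map fun φ => Real.cos (2 * m * φ)).sum / m) := by
  obtain ⟨c₀, hc₀, hg⟩ := gegenbauer_eq_const_mul_derivU l n
  set lam : ℝ := ((l + 1 : ℕ) : ℝ) with hlam
  set d : ℝ := ‖(c₀ : ℂ) * c / 2 ^ n‖ with hd
  have hd0 : d ≠ 0 := by
    rw [hd, norm_ne_zero_iff]
    exact div_ne_zero (mul_ne_zero (by exact_mod_cast hc₀) hc) (by simp)
  have habs : ∀ θ : ℝ, |gegenbauer lam n (Real.cos θ)|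
      = d * ‖(unitProd s).eval (cexp (θ * I))‖ := by
    intro θ
    have h1 : ((gegenbauer lam n (Real.cos θ) : ℝ) : ℂ)
        = c₀ * (c * (s.map fun φ => (Real.cos θ : ℂ) - (Real.cos φ : ℂ)).prod) := by
      rw [hg, ofReal_mul, ← h, ← map_derivU,
        show ((Real.cos θ : ℝ) : ℂ) = algebraMap ℝ ℂ (Real.cos θ) from rfl,
        Polynomial.eval_map_apply]
      rfl
    rw [← Real.norm_eq_abs, ← norm_real, h1, eval_unitProd_exp, hs, hd]
    simp only [norm_mul, norm_div, norm_pow, norm_exp_ofReal_mul_I, norm_ofNat, mul_one]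
    field_simp
  -- The integrand is invariant under `θ ↦ 2π - θ`, so the full circle can be used.
  have hsym : ∫ θ in (0 : ℝ)..2 * Real.pi, integrandI lam m n θ = 2 * integralI lam m n := by
    have h1 := intervalIntegral.integral_comp_sub_left (a := 0) (b := Real.pi)
      (integrandI lam m n) (2 * Real.pi)
    have h2 : ∀ θ, integrandI lam m n (2 * Real.pi - θ) = integrandI lam m n θ := by
      intro θ
      rw [integrandI, integrandI, Real.cos_two_pi_sub,
        show 2 * (m : ℝ) * (2 * Real.pi - θ) = ((2 * m : ℕ) : ℝ) * (2 * Real.pi) - 2 * m * θ by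
          push_cast; ring, Real.cos_nat_mul_two_pi_sub]
    simp_rw [h2] at h1
    rw [show 2 * Real.pi - Real.pi = Real.pi by ring, sub_zero] at h1
    rw [← intervalIntegral.integral_add_adjacent_intervals
      (intervalIntegrable_integrandI l n m 0 Real.pi)
      (intervalIntegrable_integrandI l n m Real.pi (2 * Real.pi)), ← h1, integralI]
    ring
  have hcongr : ∫ θ in (0 : ℝ)..2 * Real.pi, integrandI lam m n θ
      = ∫ θ in (0 : ℝ)..2 * Real.pi, ((2 * Real.log d) * Real.cos ((2 * m : ℕ) * θ)
        + 2 * (Real.cos ((2 * m : ℕ) * θ) * logSum s θ)) := by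
    refine intervalIntegral.integral_congr_ae ?_
    filter_upwards [ae_log_norm_unitProd s] with θ hθ _
    rw [integrandI, ← sq_abs, habs, Real.log_pow,
      Real.log_mul hd0 (norm_ne_zero_iff.mpr hθ.1), hθ.2]
    push_cast
    ring
  -- This removes the constant `d`, and with it every normalisation; it needs `m ≥ 1`.
  have hcos0 : ∫ θ in (0 : ℝ)..2 * Real.pi, Real.cos ((2 * m : ℕ) * θ) = 0 := by
    have hne : (((2 * m : ℕ) : ℝ)) ≠ 0 := by exact_mod_cast (show 2 * m ≠ 0 by omega)
    rw [intervalIntegral.integral_comp_mul_left (fun x => Real.cos x) hne, integral_cos]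
    have : Real.sin (((2 * m : ℕ) : ℝ) * (2 * Real.pi)) = 0 := by
      rw [Real.sin_eq_zero_iff]
      exact ⟨2 * (2 * m), by push_cast; ring⟩
    rw [this]
    simp
  have hcos : ContinuousOn (fun θ : ℝ => Real.cos ((2 * m : ℕ) * θ)) (Set.uIcc 0 (2 * Real.pi)) :=
    Continuous.continuousOn (by fun_prop)
  have hlog := (intervalIntegrable_logSum s 0 (2 * Real.pi)).continuousOn_mul hcos
  rw [intervalIntegral.integral_add (Continuous.intervalIntegrable (by fun_prop) _ _)
    (hlog.const_mul 2), intervalIntegral.integral_const_mul, intervalIntegral.integral_const_mul,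
    hcos0, integral_cos_mul_logSum s (by omega), hsym] at hcongr
  have hm0 : (m : ℝ) ≠ 0 := by exact_mod_cast (show m ≠ 0 by omega)
  push_cast at hcongr
  have : integralI lam m n = -(2 * Real.pi / (2 * m)) * (s.map fun φ => Real.cos (2 * m * φ)).sum := by
    linarith
  rw [this]
  field_simp

end LogIntegral

end GegenbauerEntropy

end

noncomputable section

namespace GegenbauerEntropy

open scoped Nat

/-! ### Explicit expansion of the logarithm: the multiple sum, and the quadratic case. -/

section Multinomial

open Polynomial

theorem coeff_sum_pow (q : ℕ) (b : ℕ → ℝ) (k m : ℕ) :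
    ((∑ i : Fin q, C (b i) * X ^ ((i : ℕ) + 1)) ^ k).coeff m
      = ∑ κ ∈ (Finset.piAntidiag (Finset.univ : Finset (Fin q)) k).filter
          (fun κ => ∑ i : Fin q, ((i : ℕ) + 1) * κ i = m),
        (k ! : ℝ) * ∏ i, (1 / ((κ i)! : ℝ) * b i ^ κ i) := by
  rw [Finset.sum_pow_eq_sum_piAntidiag, finsetSum_coeff, Finset.sum_filter]
  refine Finset.sum_congr rfl fun κ hκ => ?_
  rw [Finset.mem_piAntidiag] at hκ
  have e1 : ∏ i : Fin q, (C (b i) * X ^ ((i : ℕ) + 1)) ^ κ i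
      = C (∏ i : Fin q, b i ^ κ i) * X ^ (∑ i : Fin q, ((i : ℕ) + 1) * κ i) := by
    rw [map_prod, ← Finset.prod_pow_eq_pow_sum, ← Finset.prod_mul_distrib]
    refine Finset.prod_congr rfl fun i _ => ?_
    rw [mul_pow, map_pow, pow_mul]
  have e2 : (Nat.multinomial Finset.univ κ : ℝ) = k ! * ∏ i, (1 / ((κ i)! : ℝ)) := by
    have h := Nat.multinomial_spec Finset.univ κ
    rw [hκ.1] at h
    have h' : (∏ i, ((κ i)! : ℝ)) * (Nat.multinomial Finset.univ κ : ℝ) = k ! := by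
      exact_mod_cast h
    have hne : (∏ i, ((κ i)! : ℝ)) ≠ 0 := Finset.prod_ne_zero_iff.mpr fun i _ => by positivity
    rw [← h', Finset.prod_div_distrib, Finset.prod_const_one]
    field_simp
  rw [e1, ← C_eq_natCast, coeff_C_mul, coeff_C_mul, coeff_X_pow, e2, Finset.prod_mul_distrib]
  simp only [@eq_comm ℕ m]
  split_ifs <;> ring

/-- The multinomial expansion with the first two multiplicities eliminated. -/
theorem coeff_sum_pow_eq_sum_piFinset (p : ℕ) (b : ℕ → ℝ) (k m : ℕ) :
    ((∑ i : Fin (p + 2), C (b i) * X ^ ((i : ℕ) + 1)) ^ k).coeff m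
      = ∑ κ ∈ Fintype.piFinset (fun i : Fin p => Finset.Icc 0 (m / ((i : ℕ) + 3))),
        (k ! : ℝ)
          * (invFact (2 * (k : ℤ) - m + ∑ i : Fin p, (((i : ℕ) : ℤ) + 1) * (κ i : ℤ))
            * b 0 ^ (2 * (k : ℤ) - m + ∑ i : Fin p, (((i : ℕ) : ℤ) + 1) * (κ i : ℤ)).toNat)
          * (invFact ((m : ℤ) - k - ∑ i : Fin p, (((i : ℕ) : ℤ) + 2) * (κ i : ℤ))
            * b 1 ^ ((m : ℤ) - k - ∑ i : Fin p, (((i : ℕ) : ℤ) + 2) * (κ i : ℤ)).toNat)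
          * ∏ i : Fin p, (1 / ((κ i)! : ℝ) * b ((i : ℕ) + 2) ^ κ i) := by
  set u : (Fin p → ℕ) → ℤ :=
    fun κ => 2 * (k : ℤ) - m + ∑ i : Fin p, (((i : ℕ) : ℤ) + 1) * (κ i : ℤ) with hu
  set w : (Fin p → ℕ) → ℤ :=
    fun κ => (m : ℤ) - k - ∑ i : Fin p, (((i : ℕ) : ℤ) + 2) * (κ i : ℤ) with hw
  have hsplit : ∀ κ : Fin p → ℕ, ∑ i : Fin p, (((i : ℕ) : ℤ) + 2) * (κ i : ℤ)
      = ∑ i : Fin p, (((i : ℕ) : ℤ) + 1) * (κ i : ℤ) + ∑ i : Fin p, (κ i : ℤ) := by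
    intro κ
    rw [← Finset.sum_add_distrib]
    exact Finset.sum_congr rfl fun i _ => by ring
  have hsplit3 : ∀ κ : Fin p → ℕ, ∑ i : Fin p, (((i : ℕ) : ℤ) + 3) * (κ i : ℤ)
      = ∑ i : Fin p, (((i : ℕ) : ℤ) + 1) * (κ i : ℤ) + 2 * ∑ i : Fin p, (κ i : ℤ) := by
    intro κ
    rw [Finset.mul_sum, ← Finset.sum_add_distrib]
    exact Finset.sum_congr rfl fun i _ => by ring
  -- The two constraints, total multiplicity `k` and total degree `m`, are solved for `κ 0` and `κ
  -- 1`.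
  have hmem : ∀ κ : Fin (p + 2) → ℕ, (κ ∈ (Finset.piAntidiag Finset.univ k).filter
      (fun κ => ∑ i : Fin (p + 2), ((i : ℕ) + 1) * κ i = m)) ↔
      (κ 0 : ℤ) = u (fun i => κ i.succ.succ) ∧ (κ 1 : ℤ) = w (fun i => κ i.succ.succ) := by
    intro κ
    rw [Finset.mem_filter, Finset.mem_piAntidiag]
    simp only [Finset.mem_univ, implies_true, and_true, Fin.sum_univ_succ]
    have a1 : (κ 0 + (κ (Fin.succ 0) + ∑ i : Fin p, κ i.succ.succ) = k) ↔
        (κ 0 : ℤ) + κ 1 + ∑ i : Fin p, (κ i.succ.succ : ℤ) = k := by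
      rw [← Int.natCast_inj]; push_cast; rw [add_assoc]; rfl
    have a2 : ((((0 : Fin (p + 2)) : ℕ) + 1) * κ 0 + (((Fin.succ (0 : Fin (p + 1)) : ℕ) + 1)
        * κ (Fin.succ 0) + ∑ i : Fin p, ((i.succ.succ : ℕ) + 1) * κ i.succ.succ) = m) ↔
        (κ 0 : ℤ) + 2 * κ 1 + ∑ i : Fin p, (((i : ℕ) : ℤ) + 3) * (κ i.succ.succ : ℤ) = m := by
      rw [← Int.natCast_inj]
      have : ((∑ i : Fin p, ((i.succ.succ : ℕ) + 1) * κ i.succ.succ : ℕ) : ℤ)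
          = ∑ i : Fin p, (((i : ℕ) : ℤ) + 3) * (κ i.succ.succ : ℤ) := by
        push_cast
        refine Finset.sum_congr rfl fun i _ => ?_
        simp only [Fin.val_succ]
        push_cast
        ring
      rw [Nat.cast_add, Nat.cast_add, this]
      simp only [Fin.val_zero, Fin.succ_zero_eq_one, Fin.val_one]
      push_cast
      constructor <;> intro h <;> linarith
    rw [a1, a2]
    simp only [hu, hw]
    rw [hsplit, hsplit3]
    constructor
    · rintro ⟨h1, h2⟩; constructor <;> linarith
    · rintro ⟨h1, h2⟩; constructor <;> linarith
  rw [coeff_sum_pow]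
  -- Tuples for which a solved multiplicity is negative are killed by `invFact`; the rest biject
  -- with the multinomial indices.
  have hzero : ∀ κ ∈ Fintype.piFinset (fun i : Fin p => Finset.Icc 0 (m / ((i : ℕ) + 3))),
      (k ! : ℝ) * (invFact (u κ) * b 0 ^ (u κ).toNat) * (invFact (w κ) * b 1 ^ (w κ).toNat)
        * ∏ i : Fin p, (1 / ((κ i)! : ℝ) * b ((i : ℕ) + 2) ^ κ i) ≠ 0 → 0 ≤ u κ ∧ 0 ≤ w κ := by
    intro κ _ h
    constructor
    · by_contra h'
      exact h (by simp [invFact, h'])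
    · by_contra h'
      exact h (by simp [invFact, h'])
  rw [← Finset.sum_filter_of_ne hzero]
  refine Finset.sum_nbij' (fun κ i => κ i.succ.succ)
    (fun κ => Fin.cons (u κ).toNat (Fin.cons (w κ).toNat κ)) ?_ ?_ ?_ ?_ ?_
  · intro κ hκ
    have hm := (Finset.mem_filter.mp hκ).2
    rw [hmem] at hκ
    rw [Finset.mem_filter, Fintype.mem_piFinset]
    refine ⟨fun i => ?_, by rw [← hκ.1]; positivity, by rw [← hκ.2]; positivity⟩
    rw [Finset.mem_Icc, Nat.le_div_iff_mul_le (by omega)]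
    refine ⟨Nat.zero_le _, ?_⟩
    have h1 := Finset.single_le_sum (f := fun i : Fin (p + 2) => ((i : ℕ) + 1) * κ i)
      (fun _ _ => Nat.zero_le _) (Finset.mem_univ i.succ.succ)
    rw [hm] at h1
    simpa [mul_comm] using h1
  · intro κ hκ
    obtain ⟨-, h1, h2⟩ := Finset.mem_filter.mp hκ
    rw [hmem]
    have e : (fun i : Fin p => (Fin.cons (u κ).toNat (Fin.cons (w κ).toNat κ : Fin (p + 1) → ℕ)
      : Fin (p + 2) → ℕ) i.succ.succ) = κ := by
      funext i; simp
    rw [e]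
    constructor
    · simpa using h1
    · rw [show (1 : Fin (p + 2)) = Fin.succ 0 from rfl, Fin.cons_succ, Fin.cons_zero]
      exact Int.toNat_of_nonneg h2
  · intro κ hκ
    rw [hmem] at hκ
    funext i
    refine Fin.cases ?_ (fun i => Fin.cases ?_ (fun i => ?_) i) i
    · rw [Fin.cons_zero, ← hκ.1]; simp
    · rw [Fin.cons_succ, Fin.cons_zero, ← hκ.2]; simp
    · rw [Fin.cons_succ, Fin.cons_succ]
  · intro κ _
    funext i; simp
  · intro κ hκ
    rw [hmem] at hκ
    rw [← hκ.1, ← hκ.2, Fin.prod_univ_succ, Fin.prod_univ_succ]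
    simp only [invFact, Int.natCast_nonneg, if_true, Int.toNat_natCast, Fin.val_succ, Fin.val_zero,
      Fin.succ_zero_eq_one, Fin.val_one]
    ring

theorem alphaRev_sub_one (p n : ℕ) :
    alphaRev (p + 2) n - 1 = ∑ i : Fin (p + 2),
      C (alpha ((p + 2 + 1 : ℕ) : ℝ) (p + 1 - i) n / alpha ((p + 2 + 1 : ℕ) : ℝ) (p + 2) n)
        * X ^ ((i : ℕ) + 1) := by
  rw [alphaRev, Finset.sum_range_succ, div_self (alpha_ne_zero n le_rfl), ← Finset.sum_range_reflect,
    ← Fin.sum_univ_eq_sum_range (fun j => C (alpha ((p + 2 + 1 : ℕ) : ℝ) (p + 2 - 1 - j) n /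
      alpha ((p + 2 + 1 : ℕ) : ℝ) (p + 2) n) * X ^ (p + 2 - (p + 2 - 1 - j)))]
  simp only [C_1, Nat.sub_self, pow_zero, mul_one, add_sub_cancel_right]
  refine Finset.sum_congr rfl fun i _ => ?_
  have hi := i.isLt
  rw [show p + 2 - (p + 2 - 1 - (i : ℕ)) = i + 1 by omega, show p + 2 - 1 - (i : ℕ) = p + 1 - i by omega]

/-- Used with `x = α_{λ-2}`, `y = α_{λ-3}`, `w = α_{λ-1}`: it converts the monomial in the ratios
`α_ν/α_{λ-1}` to the grouping in `summand`. The exponents balance because `j₁`, `j₂` and `κ` have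
total multiplicity `k` and total degree `m`. -/
theorem pow_mul_pow_mul_prod {p : ℕ} {x y w : ℝ} (hx : x ≠ 0) (hy : y ≠ 0) (hw : w ≠ 0)
    (c : ℕ → ℝ) (κ : Fin p → ℕ) {k m j₁ j₂ : ℕ}
    (h1 : (j₁ : ℤ) = 2 * (k : ℤ) - m + ∑ i : Fin p, (((i : ℕ) : ℤ) + 1) * (κ i : ℤ))
    (h2 : (j₂ : ℤ) = (m : ℤ) - k - ∑ i : Fin p, (((i : ℕ) : ℤ) + 2) * (κ i : ℤ)) :
    (y / x) ^ m * (x ^ 2 / (w * y)) ^ k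
        * ∏ i : Fin p, (c i * x ^ ((i : ℕ) + 1) / y ^ ((i : ℕ) + 2)) ^ κ i
      = (x / w) ^ j₁ * (y / w) ^ j₂ * ∏ i : Fin p, (c i / w) ^ κ i := by
  set S₀ := ∑ i : Fin p, κ i with hS₀
  set S₁ := ∑ i : Fin p, ((i : ℕ) + 1) * κ i with hS₁
  have e1 : ∑ i : Fin p, (((i : ℕ) : ℤ) + 1) * (κ i : ℤ) = S₁ := by rw [hS₁]; push_cast; rfl
  have e2' : ∑ i : Fin p, ((i : ℕ) + 2) * κ i = S₁ + S₀ := by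
    rw [hS₁, hS₀, ← Finset.sum_add_distrib]
    exact Finset.sum_congr rfl fun i _ => by ring
  have e2 : ∑ i : Fin p, (((i : ℕ) : ℤ) + 2) * (κ i : ℤ) = S₁ + S₀ := by
    rw [← Nat.cast_add, ← e2']; push_cast; rfl
  rw [e1] at h1
  rw [e2] at h2
  have hk : k = j₁ + j₂ + S₀ := by omega
  have hm : m = j₁ + 2 * j₂ + S₁ + 2 * S₀ := by omega
  have hprod : ∏ i : Fin p, (c i * x ^ ((i : ℕ) + 1) / y ^ ((i : ℕ) + 2)) ^ κ i
      = (∏ i : Fin p, (c i / w) ^ κ i) * (w ^ S₀ * x ^ S₁ / y ^ (S₁ + S₀)) := by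
    rw [← e2', hS₀, hS₁, ← Finset.prod_pow_eq_pow_sum, ← Finset.prod_pow_eq_pow_sum,
      ← Finset.prod_pow_eq_pow_sum, ← Finset.prod_mul_distrib, ← Finset.prod_div_distrib,
      ← Finset.prod_mul_distrib]
    refine Finset.prod_congr rfl fun i _ => ?_
    rw [pow_mul, pow_mul, ← mul_pow, ← div_pow, ← mul_pow]
    congr 1
    field_simp
  rw [hprod, hk, hm]
  generalize ∏ i : Fin p, (c i / w) ^ κ i = P
  simp only [div_pow, mul_pow, pow_add, pow_mul]
  field_simp
  ring

/-- The explicit form of the coefficients of the logarithm of `alphaRev`. -/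
theorem logCoeff_alphaRev (p n m : ℕ) :
    logCoeff (alphaRev (p + 2) n : PowerSeries ℝ) m
      = -((alpha ((p + 3 : ℕ) : ℝ) p n / alpha ((p + 3 : ℕ) : ℝ) (p + 1) n) ^ m
        * multiSum (p + 3) m n) := by
  rw [logCoeff, multiSum, Finset.mul_sum, ← Finset.sum_neg_distrib]
  refine Finset.sum_congr rfl fun k hk => ?_
  obtain ⟨j, rfl⟩ : ∃ j, k = j + 1 := ⟨k - 1, by simp only [Finset.mem_Icc] at hk; omega⟩
  have e1 : ((alphaRev (p + 2) n : PowerSeries ℝ) - 1) = ((alphaRev (p + 2) n - 1 : ℝ[X])) := by simp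
  rw [e1, ← coe_pow, coeff_coe, alphaRev_sub_one, coeff_sum_pow_eq_sum_piFinset p
    (fun j => alpha ((p + 2 + 1 : ℕ) : ℝ) (p + 1 - j) n / alpha ((p + 2 + 1 : ℕ) : ℝ) (p + 2) n),
    Finset.mul_sum, Finset.mul_sum, ← Finset.sum_neg_distrib]
  refine Finset.sum_congr rfl fun κ _ => ?_
  change _ = -(_ * ((-(alpha ((p + 3 : ℕ) : ℝ) (p + 1) n ^ 2 / (alpha ((p + 3 : ℕ) : ℝ) (p + 2) n
    * alpha ((p + 3 : ℕ) : ℝ) p n))) ^ (j + 1)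
    * (((j)! : ℝ)
        * invFact (2 * ((j + 1 : ℕ) : ℤ) - m + ∑ i : Fin p, (((i : ℕ) : ℤ) + 1) * (κ i : ℤ))
        * invFact ((m : ℤ) - (j + 1 : ℕ) - ∑ i : Fin p, (((i : ℕ) : ℤ) + 2) * (κ i : ℤ)))
    * ∏ i : Fin p, (1 / ((κ i)! : ℝ)
        * (alpha ((p + 3 : ℕ) : ℝ) (p + 2 - ((i : ℕ) + 3)) n
            * alpha ((p + 3 : ℕ) : ℝ) (p + 1) n ^ ((i : ℕ) + 1)
            / alpha ((p + 3 : ℕ) : ℝ) p n ^ ((i : ℕ) + 2)) ^ (κ i))))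
  -- If either integer is negative, both sides vanish through `invFact`; otherwise `toNat` recovers
  -- it and the exponents can be compared.
  by_cases hu : 0 ≤ 2 * ((j + 1 : ℕ) : ℤ) - m + ∑ i : Fin p, (((i : ℕ) : ℤ) + 1) * (κ i : ℤ)
  swap
  · simp only [invFact, if_neg hu]; ring
  by_cases hw : 0 ≤ (m : ℤ) - (j + 1 : ℕ) - ∑ i : Fin p, (((i : ℕ) : ℤ) + 2) * (κ i : ℤ)
  swap
  · simp only [invFact, if_neg hw]; ring
  have key := pow_mul_pow_mul_prod (alpha_ne_zero n (show p + 1 ≤ p + 2 by omega))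
    (alpha_ne_zero n (show p ≤ p + 2 by omega)) (alpha_ne_zero n (le_refl (p + 2)))
    (fun i => alpha ((p + 3 : ℕ) : ℝ) (p + 2 - (i + 3)) n) κ
    (Int.toNat_of_nonneg hu) (Int.toNat_of_nonneg hw)
  have hidx : ∀ i : ℕ, p + 2 - (i + 3) = p + 1 - (i + 2) := fun i => by omega
  simp only [hidx] at key
  simp only [hidx, Finset.prod_mul_distrib, Nat.sub_zero, Nat.add_sub_cancel]
  have hneg : ∀ t : ℝ, (-t) ^ (j + 1) = (-1) ^ (j + 1) * t ^ (j + 1) := fun t => neg_pow t _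
  have hj : ((j : ℝ) + 1) ≠ 0 := by positivity
  rw [hneg, Nat.factorial_succ]
  generalize invFact _ = A₁
  generalize invFact _ = A₂
  generalize (∏ i : Fin p, 1 / ((κ i)! : ℝ)) = Q
  push_cast at key ⊢
  simp only [show (p : ℝ) + 2 + 1 = p + 3 by ring] at key ⊢
  rw [pow_succ (-1 : ℝ) (j + 1)]
  rw [div_mul_eq_mul_div, div_eq_iff hj]
  linear_combination ((-1) ^ (j + 1) * (j ! : ℝ) * ((j : ℝ) + 1) * A₁ * A₂ * Q) * key

theorem alpha_three_one (n : ℕ) : alpha ((2 + 1 : ℕ) : ℝ) 1 n = -(2 * ((n : ℝ) + 1) / (n + 4)) := by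
  simp only [alpha, poch_succ, poch_zero]
  norm_num
  rw [show (n : ℝ) + 3 + 1 = n + 4 by ring]
  ring

theorem alpha_three_two (n : ℕ) : alpha ((2 + 1 : ℕ) : ℝ) 2 n
    = ((n : ℝ) + 1) * (n + 2) / ((n + 4) * (n + 5)) := by
  simp only [alpha, poch_succ, poch_zero]
  norm_num [Nat.factorial]
  rw [show (n : ℝ) + 3 + 1 = n + 4 by ring, show (n : ℝ) + 4 + 1 = n + 5 by ring,
    show (n : ℝ) + 1 + 1 = n + 2 by ring]
  field_simp

theorem f_eq (n : ℕ) : f n = (((n : ℝ) + 5) / (n + 2) : ℝ)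
    + ((Real.sqrt (3 * ((n : ℝ) + 1) * (n + 5)) / ((n + 1) * (n + 2)) : ℝ) : ℂ) * Complex.I := by
  have h1 : (n : ℂ) + 1 ≠ 0 := Nat.cast_add_one_ne_zero n
  have h2 : (n : ℂ) + 2 ≠ 0 := by exact_mod_cast (show n + 2 ≠ 0 by omega)
  rw [f]
  push_cast
  field_simp

theorem f_re (n : ℕ) : (f n).re = ((n : ℝ) + 5) / (n + 2) := by
  rw [f_eq, Complex.add_re, Complex.re_ofReal_mul, Complex.ofReal_re, Complex.I_re]
  ring

theorem normSq_f (n : ℕ) :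
    Complex.normSq (f n) = ((n : ℝ) + 4) * (n + 5) / ((n + 1) * (n + 2)) := by
  rw [f_eq, Complex.normSq_add_mul_I, div_pow, div_pow, Real.sq_sqrt (by positivity)]
  field_simp
  ring

/-- Since `α_1/α_2 = -2 Re f` and `α_0/α_2 = |f|²`, the reciprocals of the zeros of this real
quadratic are `f` and its conjugate. -/
theorem alphaRev_two_eq_mul (n : ℕ) :
    (alphaRev 2 n).map (algebraMap ℝ ℂ)
      = (1 - C (f n) * X) * (1 - C ((starRingEnd ℂ) (f n)) * X) := by
  have e : alphaRev 2 n = 1 - C (2 * (f n).re) * X + C (Complex.normSq (f n)) * X ^ 2 := by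
    simp only [alphaRev, Finset.sum_range_succ, Finset.sum_range_zero]
    rw [alpha_zero, alpha_three_one, alpha_three_two, f_re, normSq_f]
    have e1 : -(2 * ((n : ℝ) + 1) / (n + 4)) / (((n : ℝ) + 1) * (n + 2) / ((n + 4) * (n + 5)))
        = -(2 * (((n : ℝ) + 5) / (n + 2))) := by field_simp
    have e2 : 1 / (((n : ℝ) + 1) * (n + 2) / ((n + 4) * (n + 5)))
        = ((n : ℝ) + 4) * (n + 5) / ((n + 1) * (n + 2)) := by field_simp
    rw [e1, e2, div_self (by positivity), C_neg, C_1]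
    norm_num
    ring
  have h1 : ((2 * (f n).re : ℝ) : ℂ) = f n + (starRingEnd ℂ) (f n) := by
    rw [Complex.add_conj]
  have h2 : ((Complex.normSq (f n) : ℝ) : ℂ) = f n * (starRingEnd ℂ) (f n) := by
    rw [Complex.mul_conj]
  rw [e, Polynomial.map_add, Polynomial.map_sub, Polynomial.map_mul, Polynomial.map_mul,
    Polynomial.map_one, map_C, map_C, Polynomial.map_pow, map_X, Complex.coe_algebraMap, h1, h2,
    C_add, C_mul]
  ring

theorem logCoeff_alphaRev_two (n : ℕ) {m : ℕ} (hm : 1 ≤ m) :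
    logCoeff (alphaRev 2 n : PowerSeries ℝ) m = -(2 * (f n ^ m).re / m) := by
  rw [← Complex.ofReal_inj]
  rw [← Complex.coe_algebraMap, ← logCoeff_map, ← polynomial_map_coe, alphaRev_two_eq_mul, coe_mul]
  have e : ∀ u : ℂ, ((1 - C u * X : ℂ[X]) : PowerSeries ℂ)
      = 1 - PowerSeries.C u * PowerSeries.X := fun u => by simp
  rw [e, e, logCoeff_mul (by simp) (by simp), logCoeff_one_sub_C_mul_X _ hm,
    logCoeff_one_sub_C_mul_X _ hm, ← map_pow]
  have h := Complex.add_conj (f n ^ m)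
  simp only [Complex.coe_algebraMap]
  push_cast at h ⊢
  linear_combination (-1 / (m : ℂ)) * h

/-- The integral in terms of the formal logarithm of `alphaRev`. -/
theorem integralI_eq_logCoeff {l n m : ℕ} (hm : 1 ≤ m) (hmn : m ≤ n + l + 1) :
    integralI ((l + 1 : ℕ) : ℝ) m n
      = (2 * (l : ℝ) + 1) * Real.pi / m
        - Real.pi * (alpha ((l + 1 : ℕ) : ℝ) 0 n / alpha ((l + 1 : ℕ) : ℝ) l n)
            * kdelta m (n + l + 1)
        + Real.pi * logCoeff (alphaRev l n : PowerSeries ℝ) m := by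
  obtain ⟨s, c, hs, hc, h⟩ := exists_factorization_derivU l n
  rw [integralI_eq_sum_cos hs hc h hm, sum_cos_eq_logCoeff hs hc h hm hmn, kdelta]
  split_ifs <;> ring

end Multinomial

end GegenbauerEntropy

end

theorem proposition3 :
    (∀ l n m : ℕ, 3 ≤ l → 1 ≤ m → m ≤ n + l →
      IntervalIntegrable (GegenbauerEntropy.integrandI l m n) MeasureTheory.volume 0 Real.pi ∧
      GegenbauerEntropy.integralI l m n =
        (2 * (l : ℝ) - 1) * Real.pi / m
        - Real.pi * (GegenbauerEntropy.alpha l 0 n / GegenbauerEntropy.alpha l (l - 1) n)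
            * GegenbauerEntropy.kdelta m (n + l)
        - Real.pi * (GegenbauerEntropy.alpha l (l - 3) n / GegenbauerEntropy.alpha l (l - 2) n) ^ m
            * GegenbauerEntropy.multiSum l m n) ∧
    (∀ n m : ℕ, 1 ≤ m → m ≤ n + 3 →
      GegenbauerEntropy.integralI 3 m n =
        Real.pi / m * (5 - 2 * (GegenbauerEntropy.f n ^ m).re)
        - Real.pi * ((((n : ℝ) + 4) * (n + 5)) / (((n : ℝ) + 1) * (n + 2)))
            * GegenbauerEntropy.kdelta m (n + 3)) := by
  constructor
  · intro l n m hl hm hmn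
    obtain ⟨p, rfl⟩ : ∃ p, l = p + 3 := ⟨l - 3, by omega⟩
    refine ⟨GegenbauerEntropy.intervalIntegrable_integrandI (p + 2) n m 0 Real.pi, ?_⟩
    have h := GegenbauerEntropy.integralI_eq_logCoeff (l := p + 2) (n := n) hm (by omega)
    rw [GegenbauerEntropy.logCoeff_alphaRev] at h
    rw [show p + 3 - 1 = p + 2 from rfl, show p + 3 - 2 = p + 1 from rfl,
      show p + 3 - 3 = p from rfl]
    rw [show p + 2 + 1 = p + 3 from rfl, show n + (p + 2) + 1 = n + (p + 3) from rfl] at h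
    rw [h]
    push_cast
    ring
  · intro n m hm hmn
    have h := GegenbauerEntropy.integralI_eq_logCoeff (l := 2) (n := n) hm (by omega)
    rw [GegenbauerEntropy.logCoeff_alphaRev_two n hm, GegenbauerEntropy.alpha_zero,
      GegenbauerEntropy.alpha_three_two, one_div_div] at h
    rw [show ((2 + 1 : ℕ) : ℝ) = 3 by norm_num] at h
    rw [h, show n + 2 + 1 = n + 3 from rfl]
    push_cast
    ring
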